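/- Let $X$ be a finite set. A root datum $v=(\mathfrak h,a_v,b_v,p_v)$ consists of a finite-dimensional complex vector space $\mathfrak h$, linearly independent families $(a_v(x))_{x\in X}$ in $\mathfrak h$ and $(b_v(x))_{x\in X}$ in $\mathfrak h^*$, and a map $p_v:X\to\mathbb Z/2$; its Cartan matrix is $A^v=(a^v_{xy})$, $a^v_{xy}=\langle a_v(x),b_v(y)\rangle$. An element $x\in X$ is reflectable at $v$ if (i) $a_{xx}=0$ and $p(x)=1$, or (ii) $a_{xx}\ne0$, $p(x)=0$ and $2a_{xy}/a_{xx}\in\mathbb Z_{\le0}$ for all $y\neq x$, or (iii) $a_{xx}\ne0$, $p(x)=1$ and $a_{xy}/a_{xx}\in\mathbb Z_{\le0}$ for all $y\ne x$. For $x$ reflectable at $v$ the reflexion $r_x:v\to v'$ is defined as follows. If $a_{xx}\neq0$ (anisotropic): $a_{v'}(y)=a_v(y)-2\frac{a_{yx}}{a_{xx}}a_v(x)$, $b_{v'}(y)=b_v(y)-2\frac{a_{xy}}{a_{xx}}b_v(x)$, $p_{v'}=p_v$. If $a_{xx}=0$ (isotropic): $(a,b,p)_{v'}(x)=(-a_v(x),-b_v(x),p_v(x))$;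 for $y\ne x$, $(a,b,p)_{v'}(y)=(a,b,p)_v(y)$ if $a_{xy}=0$, and $(a,b,p)_{v'}(y)=\bigl(a_v(y)+\frac{a_{yx}}{a_{xy}}a_v(x),\,b_v(y)+b_v(x),\,p_v(y)+1\bigr)$ if $a_{xy}\neq0$. The skeleton $\mathrm{Sk}(v)$ (resp. the spine $\mathrm{Sp}(v)$) is the set of root data obtained from $v$ by finite chains of reflexions (resp. isotropic reflexions). Two Cartan data $(A,p)$, $(A',p')$ are $D$-equivalent if $p=p'$ and $A=DA'$ for an invertible diagonal matrix $D$. Let $\mathrm{Sk}^D(v)$ be the set of $u\in\mathrm{Sk}(v)$ with $(A^u,p_u)$ $D$-equivalent to $(A^v,p_v)$, with the group structure with unit $v$ in which $u_1*u_2$ is the end point of the chain of reflexions starting at $u_1$ that has the same marks as a chain from $v$ to $u_2$; let $\mathrm{Sp}^D(v)=\mathrm{Sk}^D(v)\cap\mathrm{Sp}(v)$, a subgroup. Let $V_b\subset\mathfrak h^*$ be the span of $\{b_v(x)\}_{x\in X}$ (the same for all vertices of $\mathrm{Sk}(v)$), and for $u\in\mathrm{Sk}(v)$ let $\sigma^u_b\in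 GL(V_b)$ be given by $\sigma^u_b(b_v(x))=b_u(x)$ for all $x\in X$. For $u\in\mathrm{Sk}(v)$ let $\tilde{\mathfrak g}(u)$ be the Lie superalgebra generated by the commutative even space $\mathfrak h$ and elements $e_x,f_x$ ($x\in X$) of parity $p_u(x)$ with relations $[e_x,f_y]=\delta_{xy}a_u(x)$, $[h,e_x]=\langle h,b_u(x)\rangle e_x$, $[h,f_x]=-\langle h,b_u(x)\rangle f_x$. A root algebra is a family of quotients $\mathfrak g(u)$ of $\tilde{\mathfrak g}(u)$, $u\in\mathrm{Sk}(v)$, by ideals meeting $\mathfrak h$ trivially, such that for all $u,u'\in \mathrm{Sk}(v)$ the identity of $\mathfrak h$ extends to an isomorphism $\mathfrak g(u)\cong\mathfrak g(u')$. Assume that $\mathrm{Sk}(v)$ is admissible, i.e. that a root algebra exists. Let $\Delta_{an}$ be the set of all $b_u(x)$ with $u\in\mathrm{Sk}(v)$, $x$ reflectable at $u$ and $a^u_{xx}\ne0$, and let $\Sigma_{pr}$, the set of principal roots, be the set of elements of $\Delta_{an}$ of the form $b_u(x)$ with $u\in\mathrm{Sp}(v)$, $x\in X$. The parity $p(\alpha)$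 of $\alpha\in\Sigma_{pr}$ is its value under the homomorphism $\sum_x\mathbb Zb_v(x)\to\mathbb Z/2$, $b_v(x)\mapsto p_v(x)$. Theorem. The map $u\mapsto\sigma^u_b$ is an injective group homomorphism $\mathrm{Sk}^D(v)\to GL(V_b)$. Moreover, for every root algebra $\mathfrak g$ and every $\alpha\in\Sigma_{pr}$ there is a unique $\alpha^\vee\in\mathfrak h\cap[\mathfrak g(v)_\alpha,\mathfrak g(v)_{-\alpha}]$ with $\langle\alpha^\vee,\alpha\rangle=2$, and the assignment $u\mapsto\sigma_b^u|_{\Sigma_{pr}}$ is a group homomorphism from $\mathrm{Sp}^D(v)$ to the group of automorphisms of the Dynkin diagram of $\Sigma_{pr}$, that is, the group of permutations $\psi$ of $\Sigma_{pr}$ with $p(\psi(\alpha))=p(\alpha)$ and $\langle\psi(\alpha)^\vee,\psi(\beta)\rangle=\langle\alpha^\vee,\beta\rangle$ for all $\alpha,\beta\in\Sigma_{pr}$. -/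

import Mathlib

noncomputable section

set_option linter.unusedSectionVars false

/-! ## Root data, Cartan data, reflexions -/

/-- A root datum of `X` on the complex vector space `𝔥`: families `a` in `𝔥` and `b` in the dual
of `𝔥`, both linearly independent, and a parity function `p`. -/
@[ext]
structure SuperRootDatum (X : Type*) (𝔥 : Type*) [AddCommGroup 𝔥] [Module ℂ 𝔥] where
  a : X → 𝔥
  b : X → Module.Dual ℂ 𝔥
  p : X → ZMod 2
  a_indep : LinearIndependent ℂ a
  b_indep : LinearIndependent ℂ b

theorem linearIndependent_add_smul {X M : Type*} [Finite X] [AddCommGroup M] [Module ℂ M]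
    {f g : X → M} (x : X) (c : X → ℂ) (hc : c x = -2) (hf : LinearIndependent ℂ f)
    (hg : ∀ y, g y = f y + c y • f x) : LinearIndependent ℂ g := by
  classical
  cases nonempty_fintype X
  rw [Fintype.linearIndependent_iff] at hf ⊢
  intro r hr
  have key : ∑ i, (r i + if i = x then ∑ j, r j * c j else 0) • f i = 0 := by
    rw [← hr]
    simp only [add_smul, Finset.sum_add_distrib, hg, smul_add, ite_smul, zero_smul,
      Finset.sum_ite_eq', Finset.mem_univ, if_true, Finset.sum_smul, smul_smul]
  have h := hf _ key
  have hne : ∀ i, i ≠ x → r i = 0 := fun i hi => by simpa [hi] using h i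
  have hsum : ∑ j, r j * c j = r x * c x :=
    Finset.sum_eq_single x (fun j _ hj => by simp [hne j hj]) (by simp)
  have hx : r x = 0 := by
    have := h x
    rw [if_pos rfl, hsum, hc] at this
    linear_combination -this
  intro i
  by_cases hi : i = x
  · rw [hi, hx]
  · exact hne i hi

namespace SuperRootDatum

variable {X : Type*} {𝔥 : Type*} [AddCommGroup 𝔥] [Module ℂ 𝔥]

/-- The Cartan matrix of a root datum, `a_{xy} = ⟨a(x), b(y)⟩`. -/
def cartan (v : SuperRootDatum X 𝔥) : Matrix X X ℂ := fun x y => v.b y (v.a x)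

/-- `D`-equivalence of the Cartan data at `u` and `v`: the parities agree, and the Cartan matrices
agree up to left multiplication by an invertible diagonal matrix. -/
def DEquiv (u v : SuperRootDatum X 𝔥) : Prop :=
  u.p = v.p ∧ ∃ d : X → ℂ, (∀ x, d x ≠ 0) ∧ ∀ x y, u.cartan x y = d x * v.cartan x y

/-- Reflectability of `x` at `v`. -/
def Reflectable (v : SuperRootDatum X 𝔥) (x : X) : Prop :=
  (v.cartan x x = 0 ∧ v.p x = 1) ∨
  (v.cartan x x ≠ 0 ∧ v.p x = 0 ∧
    ∀ y, y ≠ x → ∃ n : ℕ, 2 * v.cartan x y / v.cartan x x = -(n : ℂ)) ∨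
  (v.cartan x x ≠ 0 ∧ v.p x = 1 ∧
    ∀ y, y ≠ x → ∃ n : ℕ, v.cartan x y / v.cartan x x = -(n : ℂ))

/-- Isotropic reflectability of `x` at `v`. -/
def IsotropicAt (v : SuperRootDatum X 𝔥) (x : X) : Prop :=
  v.Reflectable x ∧ v.cartan x x = 0

/-- Anisotropic reflectability of `x` at `v`. -/
def AnisotropicAt (v : SuperRootDatum X 𝔥) (x : X) : Prop :=
  v.Reflectable x ∧ v.cartan x x ≠ 0

/-- The formulas of the anisotropic reflexion `r_x`, for `a_{xx} ≠ 0`. -/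
def anisotropicReflexion [Finite X] (v : SuperRootDatum X 𝔥) (x : X) (hx : v.cartan x x ≠ 0) :
    SuperRootDatum X 𝔥 where
  a y := v.a y - (2 * (v.cartan y x / v.cartan x x)) • v.a x
  b y := v.b y - (2 * (v.cartan x y / v.cartan x x)) • v.b x
  p := v.p
  a_indep := linearIndependent_add_smul x (fun y => -(2 * (v.cartan y x / v.cartan x x)))
    (by simp [div_self hx]) v.a_indep (fun y => by rw [neg_smul, sub_eq_add_neg])
  b_indep := linearIndependent_add_smul x (fun y => -(2 * (v.cartan x y / v.cartan x x)))
    (by simp [div_self hx]) v.b_indep (fun y => by rw [neg_smul, sub_eq_add_neg])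

open Classical in
/-- The formulas of the isotropic reflexion `r_x`, for `a_{xx} = 0`. -/
def isotropicReflexion [Finite X] (v : SuperRootDatum X 𝔥) (x : X) : SuperRootDatum X 𝔥 where
  a y := if y = x then -v.a y else if v.cartan x y = 0 then v.a y
    else v.a y + (v.cartan y x / v.cartan x y) • v.a x
  b y := if y = x then -v.b y else if v.cartan x y = 0 then v.b y else v.b y + v.b x
  p y := if y = x then v.p y else if v.cartan x y = 0 then v.p y else v.p y + 1
  a_indep := linearIndependent_add_smul x (fun y => if y = x then -2 else
      if v.cartan x y = 0 then 0 else v.cartan y x / v.cartan x y) (by simp) v.a_indep (fun y => by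
    by_cases h : y = x
    · subst h; simp only [if_true]; module
    · by_cases h' : v.cartan x y = 0 <;> simp [h, h'])
  b_indep := linearIndependent_add_smul x (fun y => if y = x then -2 else
      if v.cartan x y = 0 then 0 else 1) (by simp) v.b_indep (fun y => by
    by_cases h : y = x
    · subst h; simp only [if_true]; module
    · by_cases h' : v.cartan x y = 0 <;> simp [h, h'])

open Classical in
/-- The target of the reflexion `r_x` at `v` (only used for `x` reflectable at `v`). -/
def reflexion [Finite X] (v : SuperRootDatum X 𝔥) (x : X) : SuperRootDatum X 𝔥 :=
  if h : v.cartan x x = 0 then v.isotropicReflexion x else v.anisotropicReflexion x h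

/-! ## Skeleton and spine -/

/-- `Path P v l u`: starting at `v` and applying successively the reflexions marked by the entries
of the list `l`, each of them satisfying `P` at the vertex where it is applied, one arrives at `u`. -/
inductive Path [Finite X] (P : SuperRootDatum X 𝔥 → X → Prop) :
    SuperRootDatum X 𝔥 → List X → SuperRootDatum X 𝔥 → Prop
  | nil (v : SuperRootDatum X 𝔥) : Path P v [] v
  | cons {v u : SuperRootDatum X 𝔥} {x : X} {l : List X} (hx : P v x)
      (h : Path P (v.reflexion x) l u) : Path P v (x :: l) u

/-- The set of vertices of the skeleton at `v`. -/
def Sk [Finite X] (v : SuperRootDatum X 𝔥) : Set (SuperRootDatum X 𝔥) :=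
  {u | ∃ l, Path Reflectable v l u}

/-- The set of vertices of the spine at `v`. -/
def Sp [Finite X] (v : SuperRootDatum X 𝔥) : Set (SuperRootDatum X 𝔥) :=
  {u | ∃ l, Path IsotropicAt v l u}

/-- `Sk^D(v)`: the vertices of the skeleton whose Cartan datum is `D`-equivalent to the one
at `v`. -/
def SkD [Finite X] (v : SuperRootDatum X 𝔥) : Type _ :=
  {u : SuperRootDatum X 𝔥 // u ∈ Sk v ∧ DEquiv u v}

section paths

variable [Finite X]

theorem Path.det {P : SuperRootDatum X 𝔥 → X → Prop} {v u u' : SuperRootDatum X 𝔥} {l : List X}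
    (h : Path P v l u) (h' : Path P v l u') : u = u' := by
  induction h with
  | nil v => cases h'; rfl
  | cons _ _ ih => cases h' with | cons _ h2 => exact ih h2

theorem Path.append {P : SuperRootDatum X 𝔥 → X → Prop} {v u w : SuperRootDatum X 𝔥}
    {l l' : List X} (h : Path P v l u) (h' : Path P u l' w) : Path P v (l ++ l') w := by
  induction h with
  | nil v => exact h'
  | cons hx _ ih => exact Path.cons hx (ih h')

theorem Path.mono {P Q : SuperRootDatum X 𝔥 → X → Prop} (hPQ : ∀ v x, P v x → Q v x)
    {v u : SuperRootDatum X 𝔥} {l : List X} (h : Path P v l u) : Path Q v l u := by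
  induction h with
  | nil v => exact Path.nil v
  | cons hx _ ih => exact Path.cons (hPQ _ _ hx) ih

theorem zmod_two_add_one_add_one (a : ZMod 2) : a + 1 + 1 = a := by
  revert a; decide

theorem reflexion_iso {v : SuperRootDatum X 𝔥} {x : X} (h : v.cartan x x = 0) :
    v.reflexion x = v.isotropicReflexion x := by
  rw [reflexion, dif_pos h]

theorem reflexion_aniso {v : SuperRootDatum X 𝔥} {x : X} (h : v.cartan x x ≠ 0) :
    v.reflexion x = v.anisotropicReflexion x h := by
  rw [reflexion, dif_neg h]

theorem iso_cartan_left {v : SuperRootDatum X 𝔥} {x : X} (h : v.cartan x x = 0) (y : X) :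
    (v.isotropicReflexion x).cartan x y = -v.cartan x y := by
  have h1 : v.b x (v.a x) = 0 := h
  by_cases hy : y = x
  · subst hy; simp [cartan, isotropicReflexion, h1]
  · by_cases h' : v.b y (v.a x) = 0 <;> simp [cartan, isotropicReflexion, hy, h', h1]

theorem iso_cartan_right {v : SuperRootDatum X 𝔥} {x : X} (h : v.cartan x x = 0) (y : X) :
    (v.isotropicReflexion x).cartan y x = -v.cartan y x := by
  have h1 : v.b x (v.a x) = 0 := h
  by_cases hy : y = x
  · subst hy; simp [cartan, isotropicReflexion, h1]
  · by_cases h' : v.b y (v.a x) = 0 <;> simp [cartan, isotropicReflexion, hy, h', h1]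

theorem aniso_cartan {v : SuperRootDatum X 𝔥} {x : X} (h : v.cartan x x ≠ 0) :
    (v.anisotropicReflexion x h).cartan = v.cartan := by
  have h1 : v.b x (v.a x) ≠ 0 := h
  ext y z
  simp only [cartan, anisotropicReflexion, map_sub, map_smul, LinearMap.sub_apply,
    LinearMap.smul_apply, smul_eq_mul]
  field_simp
  ring

theorem reflexion_invol {v : SuperRootDatum X 𝔥} {x : X} (h : v.Reflectable x) :
    (v.reflexion x).Reflectable x ∧ (v.reflexion x).reflexion x = v := by
  by_cases h0 : v.cartan x x = 0
  · rw [reflexion_iso h0]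
    have h0' : (v.isotropicReflexion x).cartan x x = 0 := by rw [iso_cartan_left h0, h0, neg_zero]
    have hp : v.p x = 1 := by
      rcases h with h | h | h
      · exact h.2
      · exact absurd h0 h.1
      · exact absurd h0 h.1
    refine ⟨Or.inl ⟨h0', by simpa [isotropicReflexion] using hp⟩, ?_⟩
    rw [reflexion_iso h0']
    have hl := iso_cartan_left h0
    have hr := iso_cartan_right h0
    ext y : 2
    · by_cases hy : y = x
      · subst hy; simp [isotropicReflexion]
      · by_cases h' : v.cartan x y = 0
        · simp only [isotropicReflexion] at hl hr ⊢
          simp [hl, hy, h']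
        · simp only [isotropicReflexion] at hl hr ⊢
          simp [hl, hr, hy, h']
    · by_cases hy : y = x
      · subst hy; simp [isotropicReflexion]
      · by_cases h' : v.cartan x y = 0
        · simp only [isotropicReflexion] at hl hr ⊢
          simp [hl, hy, h']
        · simp only [isotropicReflexion] at hl hr ⊢
          simp [hl, hy, h']
    · by_cases hy : y = x
      · subst hy; simp [isotropicReflexion]
      · by_cases h' : v.cartan x y = 0
        · simp only [isotropicReflexion] at hl hr ⊢
          simp [hl, hy, h']
        · simp only [isotropicReflexion] at hl hr ⊢
          simp [hl, hy, h', zmod_two_add_one_add_one]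
  · rw [reflexion_aniso h0]
    have hc := aniso_cartan h0
    have h0' : (v.anisotropicReflexion x h0).cartan x x ≠ 0 := by rw [hc]; exact h0
    refine ⟨?_, ?_⟩
    · unfold Reflectable
      rw [hc]
      exact h
    · rw [reflexion_aniso h0']
      have e : (2 : ℂ) * (v.cartan x x / v.cartan x x) = 2 := by rw [div_self h0, mul_one]
      ext y : 2
      · change (v.a y - _ • v.a x) - (2 * ((v.anisotropicReflexion x h0).cartan y x /
          (v.anisotropicReflexion x h0).cartan x x)) • (v.a x - _ • v.a x) = _
        rw [hc, e]
        module
      · change (v.b y - _ • v.b x) - (2 * ((v.anisotropicReflexion x h0).cartan x y /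
          (v.anisotropicReflexion x h0).cartan x x)) • (v.b x - _ • v.b x) = _
        rw [hc, e]
        module
      · rfl

theorem isotropicAt_reflexion {v : SuperRootDatum X 𝔥} {x : X} (h : v.IsotropicAt x) :
    (v.reflexion x).IsotropicAt x := by
  refine ⟨(reflexion_invol h.1).1, ?_⟩
  rw [reflexion_iso h.2, iso_cartan_left h.2, h.2, neg_zero]

theorem Path.reverse {P : SuperRootDatum X 𝔥 → X → Prop} (hP : ∀ v x, P v x → v.Reflectable x)
    (hP' : ∀ v x, P v x → P (v.reflexion x) x) {v u : SuperRootDatum X 𝔥} {l : List X}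
    (h : Path P v l u) : Path P u l.reverse v := by
  induction h with
  | nil v => exact Path.nil v
  | @cons v u x l hx h ih =>
    rw [List.reverse_cons]
    refine ih.append (Path.cons (hP' _ _ hx) ?_)
    rw [(reflexion_invol (hP _ _ hx)).2]
    exact Path.nil v

/-- `v'` is obtained from `v` by the linear maps `S`, `T` and the rescaling `d`. -/
structure Transport (S : 𝔥 →ₗ[ℂ] 𝔥) (T : Module.Dual ℂ 𝔥 →ₗ[ℂ] Module.Dual ℂ 𝔥) (d : X → ℂ)
    (v v' : SuperRootDatum X 𝔥) : Prop where
  a_eq : ∀ x, v'.a x = d x • S (v.a x)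
  b_eq : ∀ x, v'.b x = T (v.b x)
  p_eq : v'.p = v.p
  cartan_eq : ∀ x y, v'.cartan x y = d x * v.cartan x y

theorem Transport.unique {S : 𝔥 →ₗ[ℂ] 𝔥} {T : Module.Dual ℂ 𝔥 →ₗ[ℂ] Module.Dual ℂ 𝔥} {d : X → ℂ}
    {v v' v'' : SuperRootDatum X 𝔥} (h : Transport S T d v v') (h' : Transport S T d v v'') :
    v' = v'' := by
  ext x : 2
  · rw [h.a_eq, h'.a_eq]
  · rw [h.b_eq, h'.b_eq]
  · rw [h.p_eq, h'.p_eq]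

theorem Transport.reflectable {S : 𝔥 →ₗ[ℂ] 𝔥} {T : Module.Dual ℂ 𝔥 →ₗ[ℂ] Module.Dual ℂ 𝔥}
    {d : X → ℂ} (hd : ∀ x, d x ≠ 0) {v v' : SuperRootDatum X 𝔥} (h : Transport S T d v v') {x : X}
    (hx : v.Reflectable x) : v'.Reflectable x := by
  have e : ∀ y, v'.cartan x y / v'.cartan x x = v.cartan x y / v.cartan x x := fun y => by
    rw [h.cartan_eq, h.cartan_eq, mul_div_mul_left _ _ (hd x)]
  have e0 : v'.cartan x x = 0 ↔ v.cartan x x = 0 := by simp [h.cartan_eq, hd x]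
  unfold Reflectable at *
  simp only [mul_div_assoc, e, e0, h.p_eq, ne_eq] at *
  exact hx

theorem Transport.reflexion {S : 𝔥 →ₗ[ℂ] 𝔥} {T : Module.Dual ℂ 𝔥 →ₗ[ℂ] Module.Dual ℂ 𝔥}
    {d : X → ℂ} (hd : ∀ x, d x ≠ 0) {v v' : SuperRootDatum X 𝔥} (h : Transport S T d v v') (x : X) :
    Transport S T d (v.reflexion x) (v'.reflexion x) := by
  have e0 : ∀ y, v'.cartan x y = 0 ↔ v.cartan x y = 0 := fun y => by simp [h.cartan_eq, hd x]
  have ha := h.a_eq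
  have hb := h.b_eq
  have hp := h.p_eq
  have hC := h.cartan_eq
  have hC' : ∀ x y, v'.b y (v'.a x) = d x * v.b y (v.a x) := hC
  by_cases h0 : v.cartan x x = 0
  · have h0' : v'.cartan x x = 0 := (e0 x).2 h0
    rw [reflexion_iso h0, reflexion_iso h0']
    have hdx := hd x
    refine ⟨fun y => ?_, fun y => ?_, ?_, fun y z => ?_⟩
    · have hdy := hd y
      by_cases hy : y = x
      · subst hy; simp [isotropicReflexion, ha]
      · by_cases h' : v.cartan x y = 0
        · simp [isotropicReflexion, hy, h', e0, ha]
        · have h'' : ¬ v'.cartan x y = 0 := fun h => h' ((e0 y).1 h)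
          simp only [isotropicReflexion, hy, h', h'', ha, if_false, map_add, map_smul, smul_add,
            smul_smul]
          rw [hC, hC]
          congr 2
          field_simp
    · by_cases hy : y = x
      · subst hy; simp [isotropicReflexion, hb]
      · by_cases h' : v.cartan x y = 0 <;> simp [isotropicReflexion, hy, h', e0, hb]
    · funext y
      simp [isotropicReflexion, e0, hp]
    · have e1 : ∀ y, v'.b y (v'.a x) = 0 ↔ v.b y (v.a x) = 0 := e0
      have hdy := hd y
      by_cases hy : y = x
      · rw [hy, iso_cartan_left h0, iso_cartan_left h0', hC]; ring
      · by_cases hz : z = x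
        · rw [hz, iso_cartan_right h0, iso_cartan_right h0', hC]; ring
        · by_cases h1 : v.b y (v.a x) = 0 <;> by_cases h2 : v.b z (v.a x) = 0 <;>
            simp [cartan, isotropicReflexion, hy, hz, h1, h2, hC', hdx] <;> field_simp
  · have h0' : v'.cartan x x ≠ 0 := fun h => h0 ((e0 x).1 h)
    rw [reflexion_aniso h0, reflexion_aniso h0']
    have hdx := hd x
    refine ⟨fun y => ?_, fun y => ?_, ?_, fun y z => ?_⟩
    · simp only [anisotropicReflexion, ha, hC, map_sub, map_smul, smul_sub, smul_smul]
      congr 2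
      field_simp
    · simp only [anisotropicReflexion, hb, hC, map_sub, map_smul]
      congr 2
      field_simp
    · exact hp
    · rw [aniso_cartan, aniso_cartan, hC]

theorem DEquiv.transport {v v' : SuperRootDatum X 𝔥} (h : DEquiv v' v) :
    ∃ S T d, (∀ x, d x ≠ 0) ∧ Transport S T d v v' := by
  obtain ⟨hp, d, hd, hC⟩ := h
  obtain ⟨S, hS⟩ : ∃ S : 𝔥 →ₗ[ℂ] 𝔥, ∀ x, S (v.a x) = (d x)⁻¹ • v'.a x := by
    obtain ⟨S, hS⟩ := LinearMap.exists_extend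
      ((Module.Basis.span v.a_indep).constr ℂ (fun x => (d x)⁻¹ • v'.a x))
    refine ⟨S, fun x => ?_⟩
    have h2 := congrArg (fun f => f (Module.Basis.span v.a_indep x)) hS
    simp only [LinearMap.comp_apply, Module.Basis.constr_basis] at h2
    rw [← h2, Submodule.subtype_apply, Module.Basis.coe_span_apply]
  obtain ⟨T, hT⟩ : ∃ T : Module.Dual ℂ 𝔥 →ₗ[ℂ] Module.Dual ℂ 𝔥, ∀ x, T (v.b x) = v'.b x := by
    obtain ⟨S, hS⟩ := LinearMap.exists_extend
      ((Module.Basis.span v.b_indep).constr ℂ (fun x => v'.b x))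
    refine ⟨S, fun x => ?_⟩
    have h2 := congrArg (fun f => f (Module.Basis.span v.b_indep x)) hS
    simp only [LinearMap.comp_apply, Module.Basis.constr_basis] at h2
    rw [← h2, Submodule.subtype_apply, Module.Basis.coe_span_apply]
  exact ⟨S, T, d, hd, fun x => by rw [hS, smul_smul, mul_inv_cancel₀ (hd x), one_smul],
    fun x => (hT x).symm, hp, hC⟩

theorem Transport.dEquiv {S : 𝔥 →ₗ[ℂ] 𝔥} {T : Module.Dual ℂ 𝔥 →ₗ[ℂ] Module.Dual ℂ 𝔥} {d : X → ℂ}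
    (hd : ∀ x, d x ≠ 0) {v v' : SuperRootDatum X 𝔥} (h : Transport S T d v v') : DEquiv v' v :=
  ⟨h.p_eq, d, hd, h.cartan_eq⟩

theorem Transport.path {S : 𝔥 →ₗ[ℂ] 𝔥} {T : Module.Dual ℂ 𝔥 →ₗ[ℂ] Module.Dual ℂ 𝔥} {d : X → ℂ}
    (hd : ∀ x, d x ≠ 0) {P : SuperRootDatum X 𝔥 → X → Prop}
    (hP : ∀ {v v' : SuperRootDatum X 𝔥}, Transport S T d v v' → ∀ x, P v x → P v' x)
    {v v' u : SuperRootDatum X 𝔥} {l : List X} (h : Transport S T d v v') (hl : Path P v l u) :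
    ∃ u', Path P v' l u' ∧ Transport S T d u u' := by
  induction hl generalizing v' with
  | nil v => exact ⟨v', Path.nil v', h⟩
  | @cons v u x l hx _ ih =>
    obtain ⟨u', h1, h2⟩ := ih (h.reflexion hd x)
    exact ⟨u', Path.cons (hP h x hx) h1, h2⟩

theorem Transport.isotropicAt {S : 𝔥 →ₗ[ℂ] 𝔥} {T : Module.Dual ℂ 𝔥 →ₗ[ℂ] Module.Dual ℂ 𝔥}
    {d : X → ℂ} (hd : ∀ x, d x ≠ 0) {v v' : SuperRootDatum X 𝔥} (h : Transport S T d v v') (x : X)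
    (hx : v.IsotropicAt x) : v'.IsotropicAt x :=
  ⟨h.reflectable hd hx.1, by rw [h.cartan_eq, hx.2, mul_zero]⟩

theorem DEquiv.symm {u v : SuperRootDatum X 𝔥} (h : DEquiv u v) : DEquiv v u := by
  obtain ⟨hp, d, hd, hC⟩ := h
  refine ⟨hp.symm, fun x => (d x)⁻¹, fun x => inv_ne_zero (hd x), fun x y => ?_⟩
  rw [hC, inv_mul_cancel_left₀ (hd x)]

theorem DEquiv.trans {u v w : SuperRootDatum X 𝔥} (h : DEquiv u v) (h' : DEquiv v w) :
    DEquiv u w := by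
  obtain ⟨hp, d, hd, hC⟩ := h
  obtain ⟨hp', d', hd', hC'⟩ := h'
  refine ⟨hp.trans hp', fun x => d x * d' x, fun x => mul_ne_zero (hd x) (hd' x), fun x y => ?_⟩
  rw [hC, hC', mul_assoc]

theorem DEquiv.refl (v : SuperRootDatum X 𝔥) : DEquiv v v :=
  ⟨rfl, fun _ => 1, fun _ => one_ne_zero, fun _ _ => (one_mul _).symm⟩

theorem Path.reverseSk {v u : SuperRootDatum X 𝔥} {l : List X} (h : Path Reflectable v l u) :
    Path Reflectable u l.reverse v :=
  h.reverse (fun _ _ => id) (fun _ _ hx => (reflexion_invol hx).1)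

theorem Path.toSk {v u : SuperRootDatum X 𝔥} {l : List X} (h : Path IsotropicAt v l u) :
    Path Reflectable v l u :=
  h.mono (fun _ _ hx => hx.1)

theorem exists_namesake {v v' u : SuperRootDatum X 𝔥} (h : DEquiv v' v) (hu : u ∈ Sk v) :
    ∃ u', DEquiv u' u ∧ (∀ l, Path Reflectable v l u → Path Reflectable v' l u') ∧
      ∀ l, Path IsotropicAt v l u → Path IsotropicAt v' l u' := by
  obtain ⟨S, T, d, hd, ht⟩ := h.transport
  obtain ⟨l, hl⟩ := hu
  obtain ⟨u', _, h2⟩ := ht.path hd (P := Reflectable) (fun h _ hx => h.reflectable hd hx) hl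
  refine ⟨u', h2.dEquiv hd, fun l' hl' => ?_, fun l' hl' => ?_⟩
  · obtain ⟨u'', h3, h4⟩ := ht.path hd (P := Reflectable) (fun h _ hx => h.reflectable hd hx) hl'
    rwa [h2.unique h4]
  · obtain ⟨u'', h3, h4⟩ := ht.path hd (P := IsotropicAt) (fun h x hx => h.isotropicAt hd x hx) hl'
    rwa [h2.unique h4]

end paths

/-! ## The groups `Sk^D(v)` and `Sp^D(v)` -/

section group

variable [Finite X] {v : SuperRootDatum X 𝔥}

/-- For `v'` in `Sk^D(v)` and a vertex `u` of the skeleton, the vertex `σ^{v'}(u)`: the common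
endpoint of the paths starting at `v'` that are namesakes of the paths from `v` to `u`. -/
def namesake (v' : SkD v) (u : SuperRootDatum X 𝔥) (hu : u ∈ Sk v) : SuperRootDatum X 𝔥 :=
  (exists_namesake v'.2.2 hu).choose

theorem namesake_dEquiv (v' : SkD v) (u : SuperRootDatum X 𝔥) (hu : u ∈ Sk v) :
    DEquiv (namesake v' u hu) u :=
  (exists_namesake v'.2.2 hu).choose_spec.1

theorem namesake_path (v' : SkD v) (u : SuperRootDatum X 𝔥) (hu : u ∈ Sk v) {l : List X}
    (h : Path Reflectable v l u) : Path Reflectable v'.1 l (namesake v' u hu) :=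
  (exists_namesake v'.2.2 hu).choose_spec.2.1 l h

theorem namesake_isoPath (v' : SkD v) (u : SuperRootDatum X 𝔥) (hu : u ∈ Sk v) {l : List X}
    (h : Path IsotropicAt v l u) : Path IsotropicAt v'.1 l (namesake v' u hu) :=
  (exists_namesake v'.2.2 hu).choose_spec.2.2 l h

/-- The product `u₁ * u₂ = σ^{u₁}(u₂)` on `Sk^D(v)`. -/
def SkD.mul (u₁ u₂ : SkD v) : SkD v :=
  ⟨namesake u₁ u₂.1 u₂.2.1, by
    obtain ⟨l₁, h₁⟩ := u₁.2.1
    obtain ⟨l₂, h₂⟩ := u₂.2.1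
    exact ⟨l₁ ++ l₂, h₁.append (namesake_path u₁ u₂.1 u₂.2.1 h₂)⟩,
    (namesake_dEquiv u₁ u₂.1 u₂.2.1).trans u₂.2.2⟩

/-- The unit `v` of `Sk^D(v)`. -/
def SkD.one (v : SuperRootDatum X 𝔥) : SkD v := ⟨v, ⟨[], Path.nil v⟩, DEquiv.refl v⟩

theorem SkD.mul_path (u₁ u₂ : SkD v) {l : List X} (h : Path Reflectable v l u₂.1) :
    Path Reflectable u₁.1 l (SkD.mul u₁ u₂).1 :=
  namesake_path u₁ u₂.1 u₂.2.1 h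

theorem SkD.exists_left_inv (u : SkD v) : ∃ u' : SkD v, SkD.mul u' u = SkD.one v ∧
    (u.1 ∈ Sp v → u'.1 ∈ Sp v) := by
  obtain ⟨l, hl⟩ := u.2.1
  have hr : v ∈ Sk u.1 := ⟨_, hl.reverseSk⟩
  obtain ⟨w, h1, h2, h3⟩ := exists_namesake u.2.2.symm hr
  refine ⟨⟨w, ⟨_, h2 _ hl.reverseSk⟩, h1⟩, Subtype.ext ?_, ?_⟩
  · have h4 := SkD.mul_path (⟨w, ⟨_, h2 _ hl.reverseSk⟩, h1⟩ : SkD v) u hl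
    have h5 := (h2 _ hl.reverseSk).reverseSk
    rw [List.reverse_reverse] at h5
    exact h4.det h5
  · rintro ⟨m, hm⟩
    exact ⟨_, h3 _ (hm.reverse (fun _ _ hx => hx.1) (fun _ _ hx => isotropicAt_reflexion hx))⟩

/-- The inverse in `Sk^D(v)`. -/
def SkD.inv (u : SkD v) : SkD v := (SkD.exists_left_inv u).choose

instance : Mul (SkD v) := ⟨SkD.mul⟩
instance : One (SkD v) := ⟨SkD.one v⟩
instance : Inv (SkD v) := ⟨SkD.inv⟩

/-- The group `Sk^D(v)`, with `u₁ * u₂ = σ^{u₁}(u₂)` and unit `v`. -/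
instance : Group (SkD v) := Group.ofLeftAxioms
  (fun u₁ u₂ u₃ => by
    obtain ⟨l₁, h₁⟩ := u₁.2.1
    obtain ⟨l₂, h₂⟩ := u₂.2.1
    obtain ⟨l₃, h₃⟩ := u₃.2.1
    have hL := SkD.mul_path (SkD.mul u₁ u₂) u₃ h₃
    have hR := SkD.mul_path u₁ (SkD.mul u₂ u₃) (h₂.append (SkD.mul_path u₂ u₃ h₃))
    exact Subtype.ext (((SkD.mul_path u₁ u₂ h₂).append hL).det hR))
  (fun u => by
    obtain ⟨l, hl⟩ := u.2.1
    exact Subtype.ext ((SkD.mul_path (SkD.one v) u hl).det hl))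
  (fun u => (SkD.exists_left_inv u).choose_spec.1)

/-- The subgroup `Sp^D(v) = Sk^D(v) ∩ Sp(v)` of `Sk^D(v)`. -/
def SpD (v : SuperRootDatum X 𝔥) : Subgroup (SkD v) where
  carrier := {u | u.1 ∈ Sp v}
  one_mem' := ⟨[], Path.nil v⟩
  mul_mem' := by
    rintro u₁ u₂ ⟨l₁, h₁⟩ ⟨l₂, h₂⟩
    exact ⟨l₁ ++ l₂, h₁.append (namesake_isoPath u₁ u₂.1 u₂.2.1 h₂)⟩
  inv_mem' := by
    intro u hu
    exact (SkD.exists_left_inv u).choose_spec.2 hu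

end group

/-! ## The root lattice, the space `V_b` and the maps `σ_b^u` -/

section lattice

/-- The root lattice `Q_v`. -/
def rootLattice (v : SuperRootDatum X 𝔥) : Submodule ℤ (Module.Dual ℂ 𝔥) :=
  Submodule.span ℤ (Set.range v.b)

/-- The span `V_b` of the simple roots at `v`. -/
def Vb (v : SuperRootDatum X 𝔥) : Submodule ℂ (Module.Dual ℂ 𝔥) :=
  Submodule.span ℂ (Set.range v.b)

/-- The parity `p : Q_v → ℤ/2`, the homomorphism extending `b(x) ↦ p(x)`. -/
def parity (v : SuperRootDatum X 𝔥) : v.rootLattice →ₗ[ℤ] ZMod 2 :=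
  (Module.Basis.span (v.b_indep.restrict_scalars' ℤ)).constr ℤ v.p

variable [Finite X]

theorem rootLattice_reflexion {v : SuperRootDatum X 𝔥} {x : X} (h : v.Reflectable x) (y : X) :
    (v.reflexion x).b y ∈ v.rootLattice := by
  have hb : ∀ z, v.b z ∈ v.rootLattice := fun z => Submodule.subset_span ⟨z, rfl⟩
  by_cases h0 : v.cartan x x = 0
  · rw [reflexion_iso h0]
    simp only [isotropicReflexion]
    split_ifs
    · exact neg_mem (hb y)
    · exact hb y
    · exact add_mem (hb y) (hb x)
  · rw [reflexion_aniso h0]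
    have key : ∃ n : ℤ, 2 * (v.cartan x y / v.cartan x x) = (n : ℂ) := by
      by_cases hy : y = x
      · exact ⟨2, by rw [hy, div_self h0]; norm_num⟩
      · rcases h with h | h | h
        · exact absurd h.1 h0
        · obtain ⟨n, hn⟩ := h.2.2 y hy
          exact ⟨-n, by rw [← mul_div_assoc, hn]; push_cast; ring⟩
        · obtain ⟨n, hn⟩ := h.2.2 y hy
          exact ⟨-(2 * n), by rw [hn]; push_cast; ring⟩
    obtain ⟨n, hn⟩ := key
    simp only [anisotropicReflexion, hn]
    rw [Int.cast_smul_eq_zsmul]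
    exact sub_mem (hb y) (Submodule.smul_mem _ n (hb x))

theorem rootLattice_le {v u : SuperRootDatum X 𝔥} (hu : u ∈ Sk v) :
    u.rootLattice ≤ v.rootLattice := by
  obtain ⟨l, hl⟩ := hu
  induction hl with
  | nil v => exact le_rfl
  | @cons v u x l hx _ ih =>
    refine ih.trans (Submodule.span_le.2 ?_)
    rintro _ ⟨y, rfl⟩
    exact rootLattice_reflexion hx y

theorem rootLattice_le_Vb (v : SuperRootDatum X 𝔥) :
    v.rootLattice ≤ v.Vb.restrictScalars ℤ :=
  Submodule.span_le.2 Submodule.subset_span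

theorem mem_Sk_symm {v u : SuperRootDatum X 𝔥} (hu : u ∈ Sk v) : v ∈ Sk u := by
  obtain ⟨l, hl⟩ := hu
  exact ⟨_, hl.reverseSk⟩

theorem Vb_le {v u : SuperRootDatum X 𝔥} (hu : u ∈ Sk v) : u.Vb ≤ v.Vb := by
  refine Submodule.span_le.2 ?_
  rintro _ ⟨y, rfl⟩
  exact rootLattice_le_Vb v (rootLattice_le hu (Submodule.subset_span ⟨y, rfl⟩))

theorem Vb_eq {v u : SuperRootDatum X 𝔥} (hu : u ∈ Sk v) : u.Vb = v.Vb :=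
  le_antisymm (Vb_le hu) (Vb_le (mem_Sk_symm hu))

/-- The simple roots at `v`, as a basis of `V_b`. -/
def simpleBasis (v : SuperRootDatum X 𝔥) : Module.Basis X ℂ v.Vb :=
  Module.Basis.span v.b_indep

theorem coe_simpleBasis (v : SuperRootDatum X 𝔥) (x : X) :
    (v.simpleBasis x : Module.Dual ℂ 𝔥) = v.b x :=
  Module.Basis.coe_span_apply v.b_indep x

/-- The automorphism `σ_b^u` of `V_b` given by `σ_b^u (b_v(x)) = b_u(x)`, for `u` in `Sk(v)`. -/
def sigmaB (v u : SuperRootDatum X 𝔥) (hu : u ∈ Sk v) :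
    LinearMap.GeneralLinearGroup ℂ v.Vb :=
  LinearMap.GeneralLinearGroup.ofLinearEquiv
    (v.simpleBasis.equiv (u.simpleBasis.map (LinearEquiv.ofEq u.Vb v.Vb (Vb_eq hu)))
      (Equiv.refl X))

theorem sigmaB_apply (v u : SuperRootDatum X 𝔥) (hu : u ∈ Sk v) (x : X) :
    ((sigmaB v u hu : v.Vb →ₗ[ℂ] v.Vb) (v.simpleBasis x) : Module.Dual ℂ 𝔥) = u.b x := by
  change ((v.simpleBasis.equiv (u.simpleBasis.map (LinearEquiv.ofEq u.Vb v.Vb (Vb_eq hu)))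
      (Equiv.refl X) (v.simpleBasis x) : v.Vb) : Module.Dual ℂ 𝔥) = _
  rw [Module.Basis.equiv_apply, Module.Basis.map_apply, LinearEquiv.coe_ofEq_apply,
    Equiv.refl_apply, coe_simpleBasis]

/-! ## Anisotropic real roots and principal roots -/

/-- The set `Δ_an` of anisotropic real roots. -/
def anisotropicRoots (v : SuperRootDatum X 𝔥) : Set (Module.Dual ℂ 𝔥) :=
  {α | ∃ u ∈ Sk v, ∃ x, u.AnisotropicAt x ∧ α = u.b x}

/-- The set `Σ_pr` of principal roots: the anisotropic real roots that are simple at some vertex of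
the spine. -/
def principalRoots (v : SuperRootDatum X 𝔥) : Set (Module.Dual ℂ 𝔥) :=
  {α | α ∈ v.anisotropicRoots ∧ ∃ u ∈ Sp v, ∃ x, α = u.b x}

theorem principalRoots_mem_rootLattice {v : SuperRootDatum X 𝔥} {α : Module.Dual ℂ 𝔥}
    (hα : α ∈ v.principalRoots) : α ∈ v.rootLattice := by
  obtain ⟨⟨u, hu, x, _, rfl⟩, _⟩ := hα
  exact rootLattice_le hu (Submodule.subset_span ⟨x, rfl⟩)

theorem principalRoots_mem_Vb {v : SuperRootDatum X 𝔥} {α : Module.Dual ℂ 𝔥}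
    (hα : α ∈ v.principalRoots) : α ∈ v.Vb :=
  rootLattice_le_Vb v (principalRoots_mem_rootLattice hα)

/-- The parity of a principal root. -/
def principalParity (v : SuperRootDatum X 𝔥) (α : v.principalRoots) : ZMod 2 :=
  v.parity ⟨α, principalRoots_mem_rootLattice α.2⟩

end lattice

end SuperRootDatum

/-! ## Lie superalgebras and root algebras -/

/-- A complex Lie superalgebra structure on `L`; `part 0` and `part 1` are the even and the odd
part. -/
class LieSuperStructure (L : Type*) [AddCommGroup L] [Module ℂ L] where
  part : ZMod 2 → Submodule ℂ L
  isCompl : IsCompl (part 0) (part 1)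
  bracket : L →ₗ[ℂ] L →ₗ[ℂ] L
  bracket_mem : ∀ (i j : ZMod 2) (x y : L), x ∈ part i → y ∈ part j → bracket x y ∈ part (i + j)
  skew : ∀ (i j : ZMod 2) (x y : L), x ∈ part i → y ∈ part j →
    bracket x y = -((-1 : ℂ) ^ (i * j).val • bracket y x)
  jacobi : ∀ (i j : ZMod 2) (x y z : L), x ∈ part i → y ∈ part j →
    bracket x (bracket y z) =
      bracket (bracket x y) z + (-1 : ℂ) ^ (i * j).val • bracket y (bracket x z)

namespace SuperRootDatum

open LieSuperStructure

universe w

variable {X : Type*} {𝔥 : Type*} [AddCommGroup 𝔥] [Module ℂ 𝔥]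

/-- A quotient, by an ideal meeting `𝔥` trivially, of the half-baked Lie superalgebra attached to
`v`: a Lie superalgebra generated by the (commutative, even) space `𝔥`, embedded by `ι`, and by
elements `e x`, `f x` of parity `p(x)`, in which the defining relations
`[e x, f y] = δ_{xy} a(x)`, `[h, e x] = ⟨h, b(x)⟩ e x`, `[h, f x] = -⟨h, b(x)⟩ f x` hold. -/
structure HalfBakedQuotient (v : SuperRootDatum X 𝔥) where
  carrier : Type w
  [addCommGroup : AddCommGroup carrier]
  [module : Module ℂ carrier]
  [super : LieSuperStructure carrier]
  ι : 𝔥 →ₗ[ℂ] carrier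
  e : X → carrier
  f : X → carrier
  ι_injective : Function.Injective ι
  ι_mem : ∀ h, ι h ∈ part (L := carrier) 0
  e_mem : ∀ x, e x ∈ part (L := carrier) (v.p x)
  f_mem : ∀ x, f x ∈ part (L := carrier) (v.p x)
  bracket_ι_ι : ∀ h h', bracket (ι h) (ι h') = 0
  bracket_ι_e : ∀ h x, bracket (ι h) (e x) = v.b x h • e x
  bracket_ι_f : ∀ h x, bracket (ι h) (f x) = -(v.b x h • f x)
  bracket_e_f_self : ∀ x, bracket (e x) (f x) = ι (v.a x)
  bracket_e_f : ∀ x y, x ≠ y → bracket (e x) (f y) = 0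
  generated : ∀ S : Submodule ℂ carrier, (∀ h, ι h ∈ S) → (∀ x, e x ∈ S) → (∀ x, f x ∈ S) →
    (∀ y ∈ S, ∀ z ∈ S, bracket y z ∈ S) → S = ⊤

attribute [instance] HalfBakedQuotient.addCommGroup HalfBakedQuotient.module
  HalfBakedQuotient.super

/-- A root algebra on the skeleton component of `v`: a quotient of the half-baked Lie superalgebra
at each vertex, such that for any two vertices the identity of `𝔥` extends to an isomorphism of
Lie superalgebras. (Arrows of the skeleton induce the identity of `𝔥`.) -/
structure RootAlgebra [Finite X] (v : SuperRootDatum X 𝔥) where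
  alg : ∀ u, u ∈ Sk v → HalfBakedQuotient.{w} u
  iso : ∀ u (hu : u ∈ Sk v) u' (hu' : u' ∈ Sk v),
    ∃ φ : (alg u hu).carrier ≃ₗ[ℂ] (alg u' hu').carrier,
      (∀ i y, y ∈ part i → φ y ∈ part i) ∧
      (∀ y z, φ (bracket y z) = bracket (φ y) (φ z)) ∧
      ∀ h, φ ((alg u hu).ι h) = (alg u' hu').ι h

/-- The component of `v` in the skeleton is admissible: it admits a root algebra. -/
def Admissible [Finite X] (v : SuperRootDatum X 𝔥) : Prop := Nonempty (RootAlgebra.{w} v)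

/-- The weight space of weight `μ` for the action of `𝔥`. -/
def HalfBakedQuotient.weightSpace {v : SuperRootDatum X 𝔥} (𝔤 : HalfBakedQuotient.{w} v)
    (μ : Module.Dual ℂ 𝔥) : Submodule ℂ 𝔤.carrier where
  carrier := {y | ∀ h, bracket (𝔤.ι h) y = μ h • y}
  zero_mem' := by simp
  add_mem' := by
    intro y z hy hz h
    rw [map_add, hy h, hz h, smul_add]
  smul_mem' := by
    intro c y hy h
    rw [map_smul, hy h, smul_comm]

namespace RootAlgebra

variable [Finite X] {v : SuperRootDatum X 𝔥} (𝔤 : RootAlgebra.{w} v)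

/-- The root algebra at the base vertex `v`. -/
def base : HalfBakedQuotient.{w} v := 𝔤.alg v ⟨[], Path.nil v⟩

/-- `c` is a coroot of `α`: it lies in `[𝔤_α, 𝔤_{-α}]`, and `⟨c, α⟩ = 2`. -/
def IsCoroot (α : Module.Dual ℂ 𝔥) (c : 𝔥) : Prop :=
  𝔤.base.ι c ∈ Submodule.span ℂ
    {t | ∃ y ∈ 𝔤.base.weightSpace α, ∃ z ∈ 𝔤.base.weightSpace (-α), t = bracket y z} ∧
  α c = 2

/-- The coroot `α^∨` (meaningful when there is exactly one coroot of `α`). -/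
def coroot (α : Module.Dual ℂ 𝔥) : 𝔥 := Classical.epsilon (𝔤.IsCoroot α)

/-- The automorphisms of the Dynkin diagram of `Σ_pr`: the permutations of `Σ_pr` that preserve the
parity and the numbers `⟨α^∨, β⟩`. -/
def dynkinAut : Subgroup (Equiv.Perm v.principalRoots) where
  carrier := {ψ | (∀ α, v.principalParity (ψ α) = v.principalParity α) ∧
    ∀ α β : v.principalRoots, (ψ β : Module.Dual ℂ 𝔥) (𝔤.coroot (ψ α)) =
      (β : Module.Dual ℂ 𝔥) (𝔤.coroot α)}
  one_mem' := ⟨fun _ => rfl, fun _ _ => rfl⟩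
  mul_mem' := by
    rintro ψ χ ⟨h1, h2⟩ ⟨h3, h4⟩
    exact ⟨fun α => (h1 _).trans (h3 α), fun α β => (h2 _ _).trans (h4 α β)⟩
  inv_mem' := by
    rintro ψ ⟨h1, h2⟩
    refine ⟨fun α => ?_, fun α β => ?_⟩
    · have := h1 (ψ⁻¹ α)
      simp only [Equiv.Perm.inv_def, Equiv.apply_symm_apply] at this
      exact this.symm
    · have := h2 (ψ⁻¹ α) (ψ⁻¹ β)
      simp only [Equiv.Perm.inv_def, Equiv.apply_symm_apply] at this
      exact this.symm

end RootAlgebra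

end SuperRootDatum

end

/-!
The proof has two parts.

**Injectivity of `u ↦ σ_b^u`.** What has to be shown is that a vertex `u` of the skeleton is
determined by the family `b_u`. Admissibility is used only through two facts (`SignCoherent`). A
root algebra decomposes as `𝔤 = 𝔫⁻ ⊕ 𝔥 ⊕ 𝔫⁺` at each vertex (`HalfBakedQuotient.triangular`), so

* every real root `b_u(x)` is, at every vertex, a combination of the simple roots with natural
  coefficients or the opposite of one (`RootAlgebra.pos_or_neg`);
* `𝔤_β` and `𝔤_{-β}` are lines for `β = b_u(x)`, so `β` determines the line
  `ℂ a_u(x) = [𝔤_β, 𝔤_{-β}]`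
  (`RootAlgebra.exists_a_eq_smul`); this also computes the coroots (`RootAlgebra.isCoroot_iff`).

The rest is the combinatorics of a Weyl groupoid. A reflexion `r_x` changes the sign of no positive
real root except `b(x)` (`SignCoherent.pos_reflexion`), and a simple root that is negative at some
vertex is automatically reflectable (`SignCoherent.reflectable_of_neg`), so that the number of real
roots changing sign between two vertices is their distance. As in Matsumoto's theorem, two shortest
chains with the same starting vertex that lead to the same positive system are compared by
induction (`SignCoherent.eq_of_geodesic`), which reduces the claim to rank two: the chains
`r_x, r_y, r_x, …` and `r_y, r_x, r_y, …` that make all the positive roots of a plane negative have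
the same end point (`IsOpposite.eq`). There `b` is found by following the names of the walls. For
`a`, the Cartan matrix of `x`, `y` is symmetrizable, because `a_{xy}` and `a_{yx}` vanish together
(`SignCoherent.cartan_eq_zero_symm`), and a symmetrization is preserved by both reflexions, so `b`
determines `a(x)` and `a(y)`; for the other `z`, `b` determines `a(z)` up to a
scalar, which is `1` because `a(z)` is constant modulo the plane.

**Principal roots.** If `u ∈ Sk^D(v)`, the linear maps that carry `v` to `u` carry each vertex `w`
to its namesake `w'` (`SkD.exists_transport`). Hence `σ_b^u` sends `b_w(x)` to `b_{w'}(x)`, and the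
coroot `2 a_w(x) / a_{xx}` has the same pairing with `β` as that of `b_{w'}(x)` with `σ_b^u(β)`.
-/

noncomputable section

namespace SuperRootDatum

open LieSuperStructure

universe w

/-! ### Linear maps prescribed on a linearly independent family -/

theorem exists_linearMap_apply_eq {X M N : Type*} [AddCommGroup M] [Module ℂ M] [AddCommGroup N]
    [Module ℂ N] {f : X → M} (hf : LinearIndependent ℂ f) (c : X → N) :
    ∃ g : M →ₗ[ℂ] N, ∀ x, g (f x) = c x := by
  obtain ⟨g, hg⟩ := LinearMap.exists_extend ((Module.Basis.span hf).constr ℂ c)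
  refine ⟨g, fun x => ?_⟩
  have h := congrArg (fun k => k (Module.Basis.span hf x)) hg
  simp only [LinearMap.comp_apply, Module.Basis.constr_basis] at h
  rw [← h, Submodule.subtype_apply, Module.Basis.coe_span_apply]

variable {X : Type*} {𝔥 : Type*} [AddCommGroup 𝔥] [Module ℂ 𝔥]

/-- The height: a linear functional equal to `1` at every simple root. -/
theorem exists_height (v : SuperRootDatum X 𝔥) :
    ∃ ht : Module.Dual ℂ 𝔥 →ₗ[ℂ] ℂ, ∀ l : List X, ht (l.map v.b).sum = l.length := by
  obtain ⟨ht, h⟩ := exists_linearMap_apply_eq v.b_indep (fun _ => (1 : ℂ))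
  refine ⟨ht, fun l => ?_⟩
  induction l with
  | nil => simp
  | cons x l ih => simp [ih, h, add_comm]

/-! ### The weight decomposition of a quotient of the half-baked algebra -/

/-- The root datum obtained by exchanging the roles of the generators `e` and `f`; the sign in `a`
is that of the identity `[f x, e x] = -(-1)^{p(x)} [e x, f x]`. -/
def opposite (v : SuperRootDatum X 𝔥) : SuperRootDatum X 𝔥 where
  a x := (-(-1) ^ (v.p x * v.p x).val : ℂˣ) • v.a x
  b x := -v.b x
  p := v.p
  a_indep := v.a_indep.units_smul fun x => (-(-1) ^ (v.p x * v.p x).val : ℂˣ)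
  b_indep := by
    have e : (fun _ : X => (-1 : ℂˣ)) • v.b = fun x => -v.b x := by
      funext x; simp
    exact e ▸ v.b_indep.units_smul fun _ => (-1 : ℂˣ)

/-- Iterated brackets `[e x₁, [e x₂, …, [e xₙ₋₁, e xₙ]]]`, indexed by the words `x₁ … xₙ`. -/
inductive NestedBracket {L : Type*} [AddCommGroup L] [Module ℂ L] [LieSuperStructure L]
    (e : X → L) : List X → L → Prop
  | single (x : X) : NestedBracket e [x] (e x)
  | cons (x : X) {l : List X} {y : L} (h : NestedBracket e l y) :
      NestedBracket e (x :: l) (bracket (e x) y)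

namespace HalfBakedQuotient

variable {v : SuperRootDatum X 𝔥} (𝔤 : HalfBakedQuotient.{w} v)

/-- The same Lie superalgebra, with the generators `e` and `f` exchanged. -/
def opposite : HalfBakedQuotient.{w} v.opposite where
  carrier := 𝔤.carrier
  ι := 𝔤.ι
  e := 𝔤.f
  f := 𝔤.e
  ι_injective := 𝔤.ι_injective
  ι_mem := 𝔤.ι_mem
  e_mem := 𝔤.f_mem
  f_mem := 𝔤.e_mem
  bracket_ι_ι := 𝔤.bracket_ι_ι
  bracket_ι_e h x := by rw [𝔤.bracket_ι_f]; simp [SuperRootDatum.opposite]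
  bracket_ι_f h x := by rw [𝔤.bracket_ι_e]; simp [SuperRootDatum.opposite]
  bracket_e_f_self x := by
    rw [skew _ _ _ _ (𝔤.f_mem x) (𝔤.e_mem x), 𝔤.bracket_e_f_self]
    simp [SuperRootDatum.opposite, Units.smul_def]
  bracket_e_f x y h := by
    rw [skew _ _ _ _ (𝔤.f_mem x) (𝔤.e_mem y), 𝔤.bracket_e_f _ _ h.symm]
    simp
  generated S h1 h2 h3 h4 := 𝔤.generated S h1 h3 h2 h4

theorem bracket_ι (h : 𝔥) (y z : 𝔤.carrier) :
    bracket (𝔤.ι h) (bracket y z) =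
      bracket (bracket (𝔤.ι h) y) z + bracket y (bracket (𝔤.ι h) z) := by
  have hadd : ∀ i : ZMod 2, ∀ y ∈ part (L := 𝔤.carrier) i,
      bracket (𝔤.ι h) (bracket y z) =
      bracket (bracket (𝔤.ι h) y) z + bracket y (bracket (𝔤.ι h) z) := fun i y hy => by
    have := jacobi 0 i (𝔤.ι h) y z (𝔤.ι_mem h) hy
    simpa using this
  have hy : y ∈ part (L := 𝔤.carrier) 0 ⊔ part 1 := by
    rw [isCompl.sup_eq_top]; trivial
  obtain ⟨y0, h0, y1, h1, rfl⟩ := Submodule.mem_sup.1 hy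
  simp only [map_add, LinearMap.add_apply, hadd 0 y0 h0, hadd 1 y1 h1]
  abel

theorem bracket_mem_weightSpace {μ ν : Module.Dual ℂ 𝔥} {y z : 𝔤.carrier}
    (hy : y ∈ 𝔤.weightSpace μ) (hz : z ∈ 𝔤.weightSpace ν) :
    bracket y z ∈ 𝔤.weightSpace (μ + ν) := fun h => by
  rw [bracket_ι, hy h, hz h, map_smul, map_smul, LinearMap.smul_apply, LinearMap.add_apply,
    add_smul]

theorem e_mem_weightSpace (x : X) : 𝔤.e x ∈ 𝔤.weightSpace (v.b x) := fun h => 𝔤.bracket_ι_e h x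

theorem f_mem_weightSpace (x : X) : 𝔤.f x ∈ 𝔤.weightSpace (-v.b x) := fun h => by
  rw [𝔤.bracket_ι_f]; simp

theorem ι_mem_weightSpace (h : 𝔥) : 𝔤.ι h ∈ 𝔤.weightSpace 0 := fun h' => by
  rw [𝔤.bracket_ι_ι]; simp

theorem nestedBracket_mem_weightSpace {l : List X} {y : 𝔤.carrier}
    (hy : NestedBracket 𝔤.e l y) : y ∈ 𝔤.weightSpace (l.map v.b).sum := by
  induction hy with
  | single x => simpa using 𝔤.e_mem_weightSpace x
  | cons x _ ih => simpa using 𝔤.bracket_mem_weightSpace (𝔤.e_mem_weightSpace x) ih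

theorem e_ne_zero (x : X) : 𝔤.e x ≠ 0 := fun h => by
  have h1 := 𝔤.bracket_e_f_self x
  rw [h, map_zero, LinearMap.zero_apply] at h1
  exact v.a_indep.ne_zero x (𝔤.ι_injective (by rw [← h1, map_zero]))

/-- The span of the iterated brackets of the generators `e`. -/
def nilpotentPart : Submodule ℂ 𝔤.carrier :=
  Submodule.span ℂ {y | ∃ l, NestedBracket 𝔤.e l y}

theorem e_mem_nilpotentPart (x : X) : 𝔤.e x ∈ 𝔤.nilpotentPart :=
  Submodule.subset_span ⟨_, .single x⟩

theorem bracket_ι_mem_nilpotentPart (h : 𝔥) {y : 𝔤.carrier} (hy : y ∈ 𝔤.nilpotentPart) :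
    bracket (𝔤.ι h) y ∈ 𝔤.nilpotentPart := by
  refine (Submodule.span_le (p := 𝔤.nilpotentPart.comap (bracket (𝔤.ι h)))).2 ?_ hy
  rintro y ⟨l, hl⟩
  rw [SetLike.mem_coe, Submodule.mem_comap, 𝔤.nestedBracket_mem_weightSpace hl h]
  exact Submodule.smul_mem _ _ (Submodule.subset_span ⟨l, hl⟩)

theorem bracket_e_mem_nilpotentPart (x : X) {y : 𝔤.carrier} (hy : y ∈ 𝔤.nilpotentPart) :
    bracket (𝔤.e x) y ∈ 𝔤.nilpotentPart := by
  refine (Submodule.span_le (p := 𝔤.nilpotentPart.comap (bracket (𝔤.e x)))).2 ?_ hy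
  rintro y ⟨l, hl⟩
  exact Submodule.subset_span ⟨x :: l, .cons x hl⟩

theorem bracket_e_ι (h : 𝔥) (x : X) : bracket (𝔤.e x) (𝔤.ι h) = -(v.b x h • 𝔤.e x) := by
  rw [skew _ _ _ _ (𝔤.e_mem x) (𝔤.ι_mem h), 𝔤.bracket_ι_e]
  simp

theorem exists_bracket_f_e (x z : X) : ∃ h, bracket (𝔤.f x) (𝔤.e z) = 𝔤.ι h := by
  by_cases hx : x = z
  · subst hx
    exact ⟨_, 𝔤.opposite.bracket_e_f_self x⟩
  · exact ⟨0, by rw [map_zero]; exact 𝔤.opposite.bracket_e_f x z hx⟩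

/-- The operators `ad (f x)` lower `𝔫⁺` into `𝔥 + 𝔫⁺`. -/
theorem bracket_f_mem (x : X) {y : 𝔤.carrier} (hy : y ∈ 𝔤.nilpotentPart) :
    bracket (𝔤.f x) y ∈ LinearMap.range 𝔤.ι ⊔ 𝔤.nilpotentPart := by
  refine (Submodule.span_le
    (p := (LinearMap.range 𝔤.ι ⊔ 𝔤.nilpotentPart).comap (bracket (𝔤.f x)))).2 ?_ hy
  rintro y ⟨l, hl⟩
  rw [SetLike.mem_coe, Submodule.mem_comap]
  induction hl with
  | single z =>
    obtain ⟨h, e⟩ := 𝔤.exists_bracket_f_e x z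
    rw [e]
    exact Submodule.mem_sup_left ⟨h, rfl⟩
  | @cons z l y hl ih =>
    have hy : y ∈ 𝔤.nilpotentPart := Submodule.subset_span ⟨l, hl⟩
    obtain ⟨h, e⟩ := 𝔤.exists_bracket_f_e x z
    rw [jacobi _ _ _ _ _ (𝔤.f_mem x) (𝔤.e_mem z), e]
    refine Submodule.mem_sup_right (add_mem (𝔤.bracket_ι_mem_nilpotentPart h hy)
      (Submodule.smul_mem _ _ ?_))
    obtain ⟨_, ⟨h', rfl⟩, y', hy', e'⟩ := Submodule.mem_sup.1 ih
    rw [← e', map_add, bracket_e_ι]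
    exact add_mem (neg_mem (Submodule.smul_mem _ _ (𝔤.e_mem_nilpotentPart z)))
      (𝔤.bracket_e_mem_nilpotentPart z hy')

/-- The triangular decomposition: the right-hand sum is stable under all the generators, hence
under the whole algebra, hence is a subalgebra containing the generators. -/
theorem triangular : LinearMap.range 𝔤.ι ⊔ 𝔤.nilpotentPart ⊔ 𝔤.opposite.nilpotentPart = ⊤ := by
  set S : Submodule ℂ 𝔤.carrier :=
    LinearMap.range 𝔤.ι ⊔ 𝔤.nilpotentPart ⊔ 𝔤.opposite.nilpotentPart with hS
  have h0 : LinearMap.range 𝔤.ι ≤ S := le_sup_left.trans le_sup_left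
  have hp : 𝔤.nilpotentPart ≤ S := le_sup_right.trans le_sup_left
  have hm : 𝔤.opposite.nilpotentPart ≤ S := le_sup_right
  -- the normalizer of `S`, which is closed under brackets of homogeneous elements
  let K : Submodule ℂ 𝔤.carrier :=
    { carrier := {y | ∀ s ∈ S, bracket y s ∈ S}
      zero_mem' := fun s _ => by simp
      add_mem' := fun {y z} hy hz s hs => by
        rw [map_add]; exact add_mem (hy s hs) (hz s hs)
      smul_mem' := fun c y hy s hs => by
        rw [map_smul]; exact Submodule.smul_mem _ _ (hy s hs) }
  have hK : ∀ y, (∀ h, bracket y (𝔤.ι h) ∈ S) → (∀ s ∈ 𝔤.nilpotentPart, bracket y s ∈ S) →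
      (∀ s ∈ 𝔤.opposite.nilpotentPart, bracket y s ∈ S) → y ∈ K := by
    intro y h1 h2 h3 s hs
    obtain ⟨s', hs', s3, hs3, rfl⟩ := Submodule.mem_sup.1 hs
    obtain ⟨_, ⟨h, rfl⟩, s2, hs2, rfl⟩ := Submodule.mem_sup.1 hs'
    rw [map_add, map_add]
    exact add_mem (add_mem (h1 h) (h2 s2 hs2)) (h3 s3 hs3)
  have hιK : ∀ h, 𝔤.ι h ∈ K := fun h => hK _ (fun h' => by rw [𝔤.bracket_ι_ι]; exact zero_mem _)
    (fun s hs => hp (𝔤.bracket_ι_mem_nilpotentPart h hs))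
    (fun s hs => hm (𝔤.opposite.bracket_ι_mem_nilpotentPart h hs))
  have hle : LinearMap.range 𝔤.ι ⊔ 𝔤.opposite.nilpotentPart ≤ S := sup_le h0 hm
  have heK : ∀ x, 𝔤.e x ∈ K := fun x => hK _
    (fun h => by
      rw [bracket_e_ι]
      exact neg_mem (Submodule.smul_mem _ _ (hp (𝔤.e_mem_nilpotentPart x))))
    (fun s hs => hp (𝔤.bracket_e_mem_nilpotentPart x hs))
    (fun s hs => hle (𝔤.opposite.bracket_f_mem x hs))
  have hfK : ∀ x, 𝔤.f x ∈ K := fun x => hK _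
    (fun h => by
      have := 𝔤.opposite.bracket_e_ι h x
      change bracket (𝔤.f x) (𝔤.ι h) = _ at this
      rw [this]
      exact neg_mem (Submodule.smul_mem _ _ (hm (𝔤.opposite.e_mem_nilpotentPart x))))
    (fun s hs => (le_sup_left : _ ≤ S) (𝔤.bracket_f_mem x hs))
    (fun s hs => hm (𝔤.opposite.bracket_e_mem_nilpotentPart x hs))
  have hKt : K ⊓ part 0 ⊔ K ⊓ part 1 = ⊤ := by
    have hi : ∀ i, K ⊓ part i ≤ K ⊓ part 0 ⊔ K ⊓ part 1 := by
      intro i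
      fin_cases i
      · exact le_sup_left
      · exact le_sup_right
    have hbr : ∀ i j, ∀ y ∈ K ⊓ part i, ∀ z ∈ K ⊓ part j,
        bracket y z ∈ K ⊓ part 0 ⊔ K ⊓ part 1 := by
      rintro i j y ⟨hy, hy'⟩ z ⟨hz, hz'⟩
      refine hi (i + j) ⟨fun s hs => ?_, bracket_mem i j y z hy' hz'⟩
      have hj := jacobi i j y z s hy' hz'
      rw [← sub_eq_iff_eq_add] at hj
      rw [← hj]
      exact sub_mem (hy _ (hz s hs)) (Submodule.smul_mem _ _ (hz _ (hy s hs)))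
    refine 𝔤.generated _ (fun h => hi 0 ⟨hιK h, 𝔤.ι_mem h⟩) (fun x => hi _ ⟨heK x, 𝔤.e_mem x⟩)
      (fun x => hi _ ⟨hfK x, 𝔤.f_mem x⟩) (fun y hy z hz => ?_)
    obtain ⟨y0, hy0, y1, hy1, rfl⟩ := Submodule.mem_sup.1 hy
    obtain ⟨z0, hz0, z1, hz1, rfl⟩ := Submodule.mem_sup.1 hz
    simp only [map_add, LinearMap.add_apply]
    exact add_mem (add_mem (hbr _ _ _ hy0 _ hz0) (hbr _ _ _ hy1 _ hz0))
      (add_mem (hbr _ _ _ hy0 _ hz1) (hbr _ _ _ hy1 _ hz1))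
  have hKtop : ∀ y, y ∈ K := fun y => by
    have hle : K ⊓ part 0 ⊔ K ⊓ part 1 ≤ K := sup_le inf_le_left inf_le_left
    exact hle (hKt ▸ Submodule.mem_top)
  exact 𝔤.generated S (fun h => h0 ⟨h, rfl⟩) (fun x => hp (𝔤.e_mem_nilpotentPart x))
    (fun x => hm (𝔤.opposite.e_mem_nilpotentPart x)) (fun y _ z hz => hKtop y z hz)

theorem iSupIndep_weightSpace : iSupIndep 𝔤.weightSpace := by
  have h1 := Module.End.independent_iInf_maxGenEigenspace_of_forall_mapsTo
    (fun h : 𝔥 => (bracket (𝔤.ι h) : Module.End ℂ 𝔤.carrier)) (fun h h' c =>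
      Module.End.mapsTo_maxGenEigenspace_of_comm (by
        ext y
        simp [Module.End.mul_apply, 𝔤.bracket_ι h', 𝔤.bracket_ι_ι]) c)
  have h2 : Function.Injective (fun (μ : Module.Dual ℂ 𝔥) (h : 𝔥) => μ h) :=
    DFunLike.coe_injective
  refine (h1.comp h2).mono fun μ y hy => ?_
  rw [Function.comp_apply, Submodule.mem_iInf]
  intro h
  refine (Module.End.mem_maxGenEigenspace _ _ _).2 ⟨1, ?_⟩
  simp [hy h]

/-- The weight vectors in a spanning set that have weight `β` span the weight space of `β`. -/
theorem weightSpace_le_span {G : Set 𝔤.carrier} (hG : Submodule.span ℂ G = ⊤)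
    (hw : ∀ g ∈ G, ∃ μ, g ∈ 𝔤.weightSpace μ) (β : Module.Dual ℂ 𝔥) :
    𝔤.weightSpace β ≤ Submodule.span ℂ (G ∩ 𝔤.weightSpace β) := by
  intro y hy
  have hyG : y ∈ Submodule.span ℂ ((G ∩ 𝔤.weightSpace β) ∪ (G \ 𝔤.weightSpace β)) := by
    rw [Set.inter_union_sdiff, hG]; trivial
  rw [Submodule.span_union] at hyG
  obtain ⟨y1, h1, y2, h2, e⟩ := Submodule.mem_sup.1 hyG
  have h1' : y1 ∈ 𝔤.weightSpace β := (Submodule.span_le.2 Set.inter_subset_right) h1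
  have h2' : y2 ∈ 𝔤.weightSpace β := by
    rw [← add_sub_cancel_left y1 y2, e]; exact sub_mem hy h1'
  have h2'' : y2 ∈ ⨆ μ, ⨆ (_ : μ ≠ β), 𝔤.weightSpace μ := by
    refine (Submodule.span_le.2 ?_) h2
    rintro g ⟨hg, hgβ⟩
    obtain ⟨μ, hμ⟩ := hw g hg
    have hne : μ ≠ β := fun h => hgβ (h ▸ hμ)
    exact Submodule.mem_iSup_of_mem μ (Submodule.mem_iSup_of_mem hne hμ)
  have := (Submodule.disjoint_def.1 (𝔤.iSupIndep_weightSpace β)) y2 h2' h2''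
  rw [← e, this, add_zero]
  exact h1

theorem mem_weightSpace_unique {μ ν : Module.Dual ℂ 𝔥} {y : 𝔤.carrier} (hy : y ≠ 0)
    (h1 : y ∈ 𝔤.weightSpace μ) (h2 : y ∈ 𝔤.weightSpace ν) : μ = ν := by
  ext h
  exact smul_left_injective ℂ hy ((h1 h).symm.trans (h2 h))

/-- The generators of `𝔤` as a vector space: the Cartan subalgebra and the iterated brackets. -/
def spanningSet : Set 𝔤.carrier :=
  Set.range 𝔤.ι ∪ {y | ∃ l, NestedBracket 𝔤.e l y} ∪ {y | ∃ l, NestedBracket 𝔤.f l y}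

theorem span_spanningSet : Submodule.span ℂ 𝔤.spanningSet = ⊤ := by
  rw [← 𝔤.triangular, spanningSet, Submodule.span_union, Submodule.span_union,
    ← LinearMap.coe_range, Submodule.span_eq]
  rfl

theorem opposite_weight (l : List X) : (l.map v.opposite.b).sum = -(l.map v.b).sum := by
  induction l with
  | nil => simp
  | cons x l ih =>
    rw [List.map_cons, List.map_cons, List.sum_cons, List.sum_cons, ih, neg_add]
    rfl

theorem mem_spanningSet_cases {g : 𝔤.carrier} (hg : g ∈ 𝔤.spanningSet) :
    (g ∈ Set.range 𝔤.ι ∧ g ∈ 𝔤.weightSpace 0) ∨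
    (∃ l, NestedBracket 𝔤.e l g ∧ g ∈ 𝔤.weightSpace (l.map v.b).sum) ∨
    ∃ l, NestedBracket 𝔤.f l g ∧ g ∈ 𝔤.weightSpace (-(l.map v.b).sum) := by
  rcases hg with (⟨h, rfl⟩ | ⟨l, hl⟩) | ⟨l, hl⟩
  · exact Or.inl ⟨⟨h, rfl⟩, 𝔤.ι_mem_weightSpace h⟩
  · exact Or.inr (Or.inl ⟨l, hl, 𝔤.nestedBracket_mem_weightSpace hl⟩)
  · refine Or.inr (Or.inr ⟨l, hl, ?_⟩)
    rw [← opposite_weight]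
    exact 𝔤.opposite.nestedBracket_mem_weightSpace hl

theorem weightSpace_le_span_spanningSet (β : Module.Dual ℂ 𝔥) :
    𝔤.weightSpace β ≤ Submodule.span ℂ (𝔤.spanningSet ∩ 𝔤.weightSpace β) := by
  refine 𝔤.weightSpace_le_span 𝔤.span_spanningSet (fun g hg => ?_) β
  rcases 𝔤.mem_spanningSet_cases hg with h | ⟨l, _, h⟩ | ⟨l, _, h⟩
  · exact ⟨_, h.2⟩
  · exact ⟨_, h⟩
  · exact ⟨_, h⟩

theorem sum_mem_closure (v : SuperRootDatum X 𝔥) (l : List X) :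
    (l.map v.b).sum ∈ AddSubmonoid.closure (Set.range v.b) :=
  AddSubmonoid.list_sum_mem _ fun _ h => by
    obtain ⟨x, _, rfl⟩ := List.mem_map.1 h
    exact AddSubmonoid.subset_closure ⟨x, rfl⟩

/-- Every non-zero weight is a combination of the simple roots with natural coefficients, or the
opposite of one. -/
theorem weight_sign {β : Module.Dual ℂ 𝔥} (hβ : β ≠ 0) {y : 𝔤.carrier} (hy : y ≠ 0)
    (h : y ∈ 𝔤.weightSpace β) : β ∈ AddSubmonoid.closure (Set.range v.b) ∨
      -β ∈ AddSubmonoid.closure (Set.range v.b) := by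
  obtain ⟨g, ⟨hg, hgβ⟩, hg0⟩ : ∃ g ∈ 𝔤.spanningSet ∩ 𝔤.weightSpace β, g ≠ 0 := by
    by_contra! hcon
    have h1 := 𝔤.weightSpace_le_span_spanningSet β h
    rw [(Submodule.span_eq_bot).2 hcon] at h1
    exact hy h1
  rcases 𝔤.mem_spanningSet_cases hg with h | ⟨l, _, h⟩ | ⟨l, _, h⟩
  · exact absurd (𝔤.mem_weightSpace_unique hg0 hgβ h.2) hβ
  · rw [𝔤.mem_weightSpace_unique hg0 hgβ h]
    exact Or.inl (sum_mem_closure v l)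
  · rw [𝔤.mem_weightSpace_unique hg0 hgβ h, neg_neg]
    exact Or.inr (sum_mem_closure v l)

/-- The weight space of a simple root is spanned by the corresponding generator: the only word of
height `1` and weight `b x` is `x`. -/
theorem weightSpace_b (x : X) : 𝔤.weightSpace (v.b x) = Submodule.span ℂ {𝔤.e x} := by
  refine le_antisymm ((𝔤.weightSpace_le_span_spanningSet _).trans (Submodule.span_le.2 ?_)) ?_
  · rintro g ⟨hg, hgβ⟩
    by_cases hg0 : g = 0
    · rw [hg0]; exact zero_mem _
    obtain ⟨ht, hht⟩ := v.exists_height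
    have h1 : ht (v.b x) = 1 := by simpa using hht [x]
    rcases 𝔤.mem_spanningSet_cases hg with h | ⟨l, hl, h⟩ | ⟨l, _, h⟩
    · exact absurd (𝔤.mem_weightSpace_unique hg0 hgβ h.2) (v.b_indep.ne_zero x)
    · have e := 𝔤.mem_weightSpace_unique hg0 hgβ h
      have hlen : l.length = 1 := by
        have := hht l
        rw [← e, h1] at this
        exact_mod_cast this.symm
      cases hl with
      | single z =>
        have : x = z := v.b_indep.injective (by simpa using e)
        rw [this]
        exact Submodule.mem_span_singleton_self _
      | cons z hl => cases hl <;> simp at hlen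
    · have e := congrArg ht (𝔤.mem_weightSpace_unique hg0 hgβ h)
      rw [map_neg, h1, hht] at e
      have : ((1 + l.length : ℕ) : ℂ) = 0 := by push_cast; linear_combination e
      rw [Nat.cast_eq_zero] at this
      omega
  · rw [Submodule.span_singleton_le_iff_mem]
    exact 𝔤.e_mem_weightSpace x

theorem weightSpace_neg_b (x : X) : 𝔤.weightSpace (-v.b x) = Submodule.span ℂ {𝔤.f x} :=
  𝔤.opposite.weightSpace_b x

end HalfBakedQuotient

/-! ### Consequences of admissibility -/

section admissibility

variable [Finite X]

/-- The set of real roots. -/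
def realRoots (o : SuperRootDatum X 𝔥) : Set (Module.Dual ℂ 𝔥) :=
  {β | ∃ u ∈ Sk o, ∃ x, β = u.b x}

/-- `β` is a combination of the simple roots at `t` with natural coefficients. -/
def Pos (t : SuperRootDatum X 𝔥) (β : Module.Dual ℂ 𝔥) : Prop :=
  β ∈ AddSubmonoid.closure (Set.range t.b)

namespace RootAlgebra

variable {o : SuperRootDatum X 𝔥}

theorem pos_or_neg (𝔤 : RootAlgebra.{w} o) {β : Module.Dual ℂ 𝔥} (hβ : β ∈ o.realRoots)
    {t : SuperRootDatum X 𝔥} (ht : t ∈ Sk o) : t.Pos β ∨ t.Pos (-β) := by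
  obtain ⟨u, hu, x, rfl⟩ := hβ
  obtain ⟨φ, _, h2, h3⟩ := 𝔤.iso u hu t ht
  refine (𝔤.alg t ht).weight_sign (u.b_indep.ne_zero x) (y := φ ((𝔤.alg u hu).e x))
    (fun h => (𝔤.alg u hu).e_ne_zero x (by simpa using h)) fun h => ?_
  rw [← h3, ← h2, (𝔤.alg u hu).bracket_ι_e, map_smul]

/-- If `b_u(x) = b_t(z)` then `a_u(x)` and `a_t(z)` span the same line `[𝔤_β, 𝔤_{-β}]`. -/
theorem exists_a_eq_smul (𝔤 : RootAlgebra.{w} o) {u t : SuperRootDatum X 𝔥} (hu : u ∈ Sk o)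
    (ht : t ∈ Sk o) {x z : X} (h : u.b x = t.b z) : ∃ c : ℂ, u.a x = c • t.a z := by
  obtain ⟨φ, _, h2, h3⟩ := 𝔤.iso u hu t ht
  have he : φ ((𝔤.alg u hu).e x) ∈ (𝔤.alg t ht).weightSpace (t.b z) := fun k => by
    rw [← h3, ← h2, (𝔤.alg u hu).bracket_ι_e, map_smul, h]
  have hf : φ ((𝔤.alg u hu).f x) ∈ (𝔤.alg t ht).weightSpace (-t.b z) := fun k => by
    rw [← h3, ← h2, (𝔤.alg u hu).bracket_ι_f, map_neg, map_smul, ← h, LinearMap.neg_apply, neg_smul]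
  rw [HalfBakedQuotient.weightSpace_b, Submodule.mem_span_singleton] at he
  rw [HalfBakedQuotient.weightSpace_neg_b, Submodule.mem_span_singleton] at hf
  obtain ⟨c, hc⟩ := he
  obtain ⟨d, hd⟩ := hf
  refine ⟨c * d, (𝔤.alg t ht).ι_injective ?_⟩
  rw [← h3, ← (𝔤.alg u hu).bracket_e_f_self, h2, ← hc, ← hd, map_smul, map_smul, map_smul,
    LinearMap.smul_apply, (𝔤.alg t ht).bracket_e_f_self, smul_smul, mul_comm]

/-- The coroot of a simple root `b_u(x)` with `a_{xx} ≠ 0`. -/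
theorem isCoroot_iff (𝔤 : RootAlgebra.{w} o) {u : SuperRootDatum X 𝔥} (hu : u ∈ Sk o) {x : X}
    (hx : u.cartan x x ≠ 0) (c : 𝔥) : 𝔤.IsCoroot (u.b x) c ↔ c = (2 / u.cartan x x) • u.a x := by
  have ho : o ∈ Sk o := ⟨[], Path.nil o⟩
  obtain ⟨φ, _, h2, h3⟩ := 𝔤.iso u hu o ho
  have hφ : ∀ (μ : Module.Dual ℂ 𝔥) y, y ∈ (𝔤.alg u hu).weightSpace μ ↔
      φ y ∈ (𝔤.alg o ho).weightSpace μ := fun μ y => by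
    refine forall_congr' fun h => ?_
    rw [← h3, ← h2, ← map_smul φ, φ.injective.eq_iff]
  have key : Submodule.span ℂ {t | ∃ y ∈ (𝔤.alg o ho).weightSpace (u.b x),
      ∃ z ∈ (𝔤.alg o ho).weightSpace (-u.b x), t = bracket y z} =
      Submodule.span ℂ {(𝔤.alg o ho).ι (u.a x)} := by
    have ha : (𝔤.alg o ho).ι (u.a x) =
        (bracket (φ ((𝔤.alg u hu).e x)) (φ ((𝔤.alg u hu).f x)) : (𝔤.alg o ho).carrier) := by
      rw [← h2, (𝔤.alg u hu).bracket_e_f_self, h3]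
    refine le_antisymm (Submodule.span_le.2 ?_) ((Submodule.span_singleton_le_iff_mem _ _).2 ?_)
    · rintro _ ⟨y, hy, z, hz, rfl⟩
      obtain ⟨y, rfl⟩ := φ.surjective y
      obtain ⟨z, rfl⟩ := φ.surjective z
      rw [← hφ, HalfBakedQuotient.weightSpace_b, Submodule.mem_span_singleton] at hy
      rw [← hφ, HalfBakedQuotient.weightSpace_neg_b, Submodule.mem_span_singleton] at hz
      obtain ⟨c, rfl⟩ := hy
      obtain ⟨d, rfl⟩ := hz
      refine Submodule.mem_span_singleton.2 ⟨c * d, ?_⟩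
      rw [ha, mul_smul, map_smul, map_smul, map_smul, LinearMap.smul_apply, map_smul]
    · exact Submodule.subset_span ⟨_, (hφ _ _).1 ((𝔤.alg u hu).e_mem_weightSpace x), _,
        (hφ _ _).1 ((𝔤.alg u hu).f_mem_weightSpace x), ha⟩
  change (𝔤.alg o ho).ι c ∈ Submodule.span ℂ {t | ∃ y ∈ (𝔤.alg o ho).weightSpace (u.b x),
    ∃ z ∈ (𝔤.alg o ho).weightSpace (-u.b x), t = bracket y z} ∧ u.b x c = 2 ↔ _
  rw [key, Submodule.mem_span_singleton]
  constructor
  · rintro ⟨⟨k, hk⟩, h⟩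
    rw [← map_smul] at hk
    have e := (𝔤.alg o ho).ι_injective hk
    rw [← e, map_smul, smul_eq_mul] at h
    rw [← e, eq_div_of_mul_eq hx h]
  · rintro rfl
    refine ⟨⟨_, (map_smul _ _ _).symm⟩, ?_⟩
    rw [map_smul, smul_eq_mul]
    exact div_mul_cancel₀ _ hx

end RootAlgebra

end admissibility

/-! ### Coordinates with respect to the simple roots -/

open Classical in
/-- The coordinate at `x` with respect to the simple roots at `t`, extended to the dual of `𝔥` in
an arbitrary way. -/
def coord (t : SuperRootDatum X 𝔥) (x : X) : Module.Dual ℂ 𝔥 →ₗ[ℂ] ℂ :=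
  (exists_linearMap_apply_eq t.b_indep (Pi.single x (1 : ℂ))).choose

theorem coord_b_self (t : SuperRootDatum X 𝔥) (x : X) : t.coord x (t.b x) = 1 := by
  classical
  rw [coord, (exists_linearMap_apply_eq t.b_indep (Pi.single x (1 : ℂ))).choose_spec,
    Pi.single_eq_same]

theorem coord_b_of_ne (t : SuperRootDatum X 𝔥) {x y : X} (h : y ≠ x) : t.coord x (t.b y) = 0 := by
  classical
  rw [coord, (exists_linearMap_apply_eq t.b_indep (Pi.single x (1 : ℂ))).choose_spec,
    Pi.single_eq_of_ne h]

theorem b_mem_Vb (t : SuperRootDatum X 𝔥) (x : X) : t.b x ∈ t.Vb := Submodule.subset_span ⟨x, rfl⟩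

theorem b_mem_rootLattice (t : SuperRootDatum X 𝔥) (x : X) : t.b x ∈ t.rootLattice :=
  Submodule.subset_span ⟨x, rfl⟩

theorem sum_coord_smul [Fintype X] {t : SuperRootDatum X 𝔥} {β : Module.Dual ℂ 𝔥}
    (hβ : β ∈ t.Vb) : ∑ x, t.coord x β • t.b x = β := by
  induction hβ using Submodule.span_induction with
  | mem β h =>
    obtain ⟨y, rfl⟩ := h
    rw [Finset.sum_eq_single y (fun x _ hx => by rw [coord_b_of_ne _ hx.symm, zero_smul])
      (by simp), coord_b_self, one_smul]
  | zero => simp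
  | add β γ _ _ h1 h2 => simp only [map_add, add_smul, Finset.sum_add_distrib, h1, h2]
  | smul c β _ h => simp only [map_smul, smul_eq_mul, mul_smul, ← Finset.smul_sum, h]

/-- A functional with values in `ℤ k` on the simple roots has values in `ℤ k` on the root lattice;
the case `k = 2` serves the odd anisotropic roots. -/
theorem exists_int_of_mem_rootLattice {t : SuperRootDatum X 𝔥} (f : Module.Dual ℂ 𝔥 →ₗ[ℂ] ℂ)
    {k : ℂ} (hf : ∀ x, ∃ n : ℤ, f (t.b x) = n * k) {β : Module.Dual ℂ 𝔥} (hβ : β ∈ t.rootLattice) :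
    ∃ n : ℤ, f β = n * k := by
  induction hβ using Submodule.span_induction with
  | mem β h =>
    obtain ⟨y, rfl⟩ := h
    exact hf y
  | zero => exact ⟨0, by simp⟩
  | add β γ _ _ h1 h2 =>
    obtain ⟨m, hm⟩ := h1
    obtain ⟨n, hn⟩ := h2
    exact ⟨m + n, by rw [map_add, hm, hn]; push_cast; ring⟩
  | smul c β _ h =>
    obtain ⟨m, hm⟩ := h
    exact ⟨c * m, by rw [map_zsmul, hm, zsmul_eq_mul]; push_cast; ring⟩

theorem exists_int_coord {t : SuperRootDatum X 𝔥} {β : Module.Dual ℂ 𝔥} (hβ : β ∈ t.rootLattice)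
    (x : X) : ∃ n : ℤ, t.coord x β = n := by
  obtain ⟨n, hn⟩ := exists_int_of_mem_rootLattice (t := t) (t.coord x) (k := 1) (fun y => by
    by_cases h : y = x
    · exact ⟨1, by rw [h, coord_b_self]; simp⟩
    · exact ⟨0, by rw [coord_b_of_ne _ h]; simp⟩) hβ
  exact ⟨n, by rw [hn, mul_one]⟩

theorem pos_b (t : SuperRootDatum X 𝔥) (x : X) : t.Pos (t.b x) :=
  AddSubmonoid.subset_closure ⟨x, rfl⟩

theorem Pos.mem_Vb {t : SuperRootDatum X 𝔥} {β : Module.Dual ℂ 𝔥} (h : t.Pos β) : β ∈ t.Vb :=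
  (AddSubmonoid.closure_le (S := t.Vb.toAddSubmonoid)).2 Submodule.subset_span h

theorem Pos.exists_nat {t : SuperRootDatum X 𝔥} (f : Module.Dual ℂ 𝔥 →ₗ[ℂ] ℂ)
    (hf : ∀ x, ∃ n : ℕ, f (t.b x) = n) {β : Module.Dual ℂ 𝔥} (hβ : t.Pos β) :
    ∃ n : ℕ, f β = n := by
  induction hβ using AddSubmonoid.closure_induction with
  | mem β h =>
    obtain ⟨y, rfl⟩ := h
    exact hf y
  | zero => exact ⟨0, by simp⟩
  | add β γ _ _ h1 h2 =>
    obtain ⟨m, hm⟩ := h1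
    obtain ⟨n, hn⟩ := h2
    exact ⟨m + n, by rw [map_add, hm, hn, Nat.cast_add]⟩

theorem Pos.coord {t : SuperRootDatum X 𝔥} {β : Module.Dual ℂ 𝔥} (hβ : t.Pos β) (x : X) :
    ∃ n : ℕ, t.coord x β = n :=
  hβ.exists_nat _ fun y => by
    by_cases h : y = x
    · exact ⟨1, by rw [h, coord_b_self]; simp⟩
    · exact ⟨0, by rw [coord_b_of_ne _ h]; simp⟩

theorem eq_zero_of_eq_natCast_of_neg_eq_natCast {z : ℂ} {m n : ℕ} (h1 : z = m)
    (h2 : -z = n) : z = 0 := by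
  have : ((m + n : ℕ) : ℂ) = 0 := by push_cast; rw [← h1, ← h2]; ring
  rw [Nat.cast_eq_zero] at this
  rw [h1, show m = 0 by omega, Nat.cast_zero]

theorem Pos.coord_eq_zero {t : SuperRootDatum X 𝔥} {β : Module.Dual ℂ 𝔥} (h1 : t.Pos β)
    {t' : SuperRootDatum X 𝔥} (h2 : t'.Pos (-β)) {x : X}
    (hf : ∀ y, ∃ n : ℕ, t.coord x (t'.b y) = n) : t.coord x β = 0 := by
  obtain ⟨m, hm⟩ := h1.coord x
  obtain ⟨n, hn⟩ := h2.exists_nat _ hf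
  exact eq_zero_of_eq_natCast_of_neg_eq_natCast hm (by rw [← map_neg, hn])

theorem Pos.eq_zero [Finite X] {t : SuperRootDatum X 𝔥} {β : Module.Dual ℂ 𝔥} (h1 : t.Pos β)
    (h2 : t.Pos (-β)) : β = 0 := by
  cases nonempty_fintype X
  rw [← sum_coord_smul h1.mem_Vb]
  refine Finset.sum_eq_zero fun x _ => ?_
  rw [h1.coord_eq_zero h2 (fun y => (t.pos_b y).coord x), zero_smul]

variable [Finite X]

/-! ### The form of a reflexion -/

theorem reflexion_b_self {v : SuperRootDatum X 𝔥} (x : X) : (v.reflexion x).b x = -v.b x := by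
  by_cases h0 : v.cartan x x = 0
  · rw [reflexion_iso h0]; simp [isotropicReflexion]
  · rw [reflexion_aniso h0]
    simp only [anisotropicReflexion, div_self h0]
    module

theorem reflexion_a_self {v : SuperRootDatum X 𝔥} (x : X) : (v.reflexion x).a x = -v.a x := by
  by_cases h0 : v.cartan x x = 0
  · rw [reflexion_iso h0]; simp [isotropicReflexion]
  · rw [reflexion_aniso h0]
    simp only [anisotropicReflexion, div_self h0]
    module

theorem reflexion_p_self {v : SuperRootDatum X 𝔥} (x : X) : (v.reflexion x).p x = v.p x := by
  by_cases h0 : v.cartan x x = 0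
  · rw [reflexion_iso h0]; simp [isotropicReflexion]
  · rw [reflexion_aniso h0]; rfl

theorem reflexion_b_of_cartan_eq_zero {v : SuperRootDatum X 𝔥} {x y : X} (hy : y ≠ x)
    (h : v.cartan x y = 0) : (v.reflexion x).b y = v.b y := by
  by_cases h0 : v.cartan x x = 0
  · rw [reflexion_iso h0]; simp [isotropicReflexion, hy, h]
  · rw [reflexion_aniso h0]; simp [anisotropicReflexion, h]

theorem exists_reflexion_a {v : SuperRootDatum X 𝔥} {x y : X} (hy : y ≠ x) :
    ∃ d : ℂ, (v.reflexion x).a y = v.a y + d • v.a x := by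
  by_cases h0 : v.cartan x x = 0
  · rw [reflexion_iso h0]
    by_cases h : v.cartan x y = 0
    · exact ⟨0, by simp [isotropicReflexion, hy, h]⟩
    · exact ⟨v.cartan y x / v.cartan x y, by simp [isotropicReflexion, hy, h]⟩
  · rw [reflexion_aniso h0]
    exact ⟨-(2 * (v.cartan y x / v.cartan x x)), by
      rw [neg_smul, ← sub_eq_add_neg]; rfl⟩

theorem exists_reflexion_b {v : SuperRootDatum X 𝔥} {x y : X} (hx : v.Reflectable x) (hy : y ≠ x) :
    ∃ c : ℕ, (v.reflexion x).b y = v.b y + c • v.b x ∧ (v.cartan x y ≠ 0 → c ≠ 0) ∧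
      (v.reflexion x).p y = v.p y + c • v.p x := by
  by_cases h0 : v.cartan x x = 0
  · have hp : v.p x = 1 := by
      rcases hx with h | h | h
      · exact h.2
      · exact absurd h0 h.1
      · exact absurd h0 h.1
    rw [reflexion_iso h0]
    by_cases h : v.cartan x y = 0
    · exact ⟨0, by simp [isotropicReflexion, hy, h]⟩
    · exact ⟨1, by simp [isotropicReflexion, hy, h, hp]⟩
  · rw [reflexion_aniso h0]
    have key : ∀ n : ℕ, 2 * (v.cartan x y / v.cartan x x) = -(n : ℂ) →
        (v.anisotropicReflexion x h0).b y = v.b y + n • v.b x ∧ (v.cartan x y ≠ 0 → n ≠ 0) := by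
      intro n hn
      refine ⟨?_, ?_⟩
      · simp only [anisotropicReflexion, hn]
        rw [neg_smul, sub_neg_eq_add, Nat.cast_smul_eq_nsmul]
      · rintro h rfl
        simp [h, h0] at hn
    rcases hx with h | h | h
    · exact absurd h.1 h0
    · obtain ⟨n, hn⟩ := h.2.2 y hy
      obtain ⟨h1, h2⟩ := key n (by rw [← mul_div_assoc, hn])
      exact ⟨n, h1, h2, by rw [h.2.1]; simp [anisotropicReflexion]⟩
    · obtain ⟨n, hn⟩ := h.2.2 y hy
      obtain ⟨h1, h2⟩ := key (2 * n) (by rw [hn]; push_cast; ring)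
      refine ⟨2 * n, h1, h2, ?_⟩
      rw [mul_smul, two_nsmul, CharTwo.add_self_eq_zero, add_zero]
      rfl

/-! ### Parity of real roots -/

/-- The simple roots, as a basis of the root lattice. -/
def latticeBasis (v : SuperRootDatum X 𝔥) : Module.Basis X ℤ v.rootLattice :=
  Module.Basis.span (v.b_indep.restrict_scalars' ℤ)

omit [Finite X] in
theorem latticeBasis_apply (v : SuperRootDatum X 𝔥) (x : X) :
    v.latticeBasis x = ⟨v.b x, v.b_mem_rootLattice x⟩ :=
  Subtype.ext (Module.Basis.coe_span_apply _ _)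

omit [Finite X] in
theorem parity_b_self (v : SuperRootDatum X 𝔥) (x : X) :
    v.parity ⟨v.b x, v.b_mem_rootLattice x⟩ = v.p x := by
  have h : v.parity = v.latticeBasis.constr ℤ v.p := rfl
  rw [← latticeBasis_apply, h]
  exact Module.Basis.constr_basis _ _ _ _

theorem reflexion_mem_Sk {v : SuperRootDatum X 𝔥} {x : X} (hx : v.Reflectable x) :
    v.reflexion x ∈ Sk v := ⟨[x], .cons hx (.nil _)⟩

theorem mem_Sk_trans {v u w : SuperRootDatum X 𝔥} (h : u ∈ Sk v) (h' : w ∈ Sk u) : w ∈ Sk v := by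
  obtain ⟨l, hl⟩ := h
  obtain ⟨l', hl'⟩ := h'
  exact ⟨_, hl.append hl'⟩

theorem parity_reflexion {v : SuperRootDatum X 𝔥} {x : X} (hx : v.Reflectable x)
    (β : (v.reflexion x).rootLattice) :
    v.parity (Submodule.inclusion (rootLattice_le (reflexion_mem_Sk hx)) β) =
      (v.reflexion x).parity β := by
  have hle := rootLattice_le (reflexion_mem_Sk hx)
  have key : v.parity ∘ₗ Submodule.inclusion hle = (v.reflexion x).parity := by
    refine (v.reflexion x).latticeBasis.ext fun y => ?_
    rw [latticeBasis_apply, parity_b_self, LinearMap.comp_apply]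
    by_cases hy : y = x
    · subst hy
      have e : Submodule.inclusion hle ⟨(v.reflexion y).b y,
          (v.reflexion y).b_mem_rootLattice y⟩ = -⟨v.b y, v.b_mem_rootLattice y⟩ :=
        Subtype.ext (reflexion_b_self y)
      rw [e, map_neg, parity_b_self, reflexion_p_self, ZMod.neg_eq_self_mod_two]
    · obtain ⟨c, h1, _, h2⟩ := exists_reflexion_b hx hy
      have e : Submodule.inclusion hle ⟨(v.reflexion x).b y,
          (v.reflexion x).b_mem_rootLattice y⟩ =
          ⟨v.b y, v.b_mem_rootLattice y⟩ + c • ⟨v.b x, v.b_mem_rootLattice x⟩ := Subtype.ext h1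
      rw [e, map_add, map_nsmul, parity_b_self, parity_b_self, h2]
  exact LinearMap.congr_fun key β

theorem parity_b {v u : SuperRootDatum X 𝔥} (hu : u ∈ Sk v) (y : X) :
    v.parity ⟨u.b y, rootLattice_le hu (u.b_mem_rootLattice y)⟩ = u.p y := by
  obtain ⟨l, hl⟩ := hu
  induction hl with
  | nil v => exact parity_b_self v y
  | @cons v u x l hx h ih =>
    rw [← ih, ← parity_reflexion hx]
    rfl

/-! ### Sign coherence -/

/-- The two consequences of admissibility on which the combinatorics of the skeleton rests. -/
structure SignCoherent (o : SuperRootDatum X 𝔥) : Prop where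
  /-- Every real root is positive or negative at every vertex. -/
  pos_or_neg : ∀ β ∈ o.realRoots, ∀ t ∈ Sk o, t.Pos β ∨ t.Pos (-β)
  /-- A simple root determines the line spanned by `a(x)`. -/
  exists_a_eq_smul : ∀ u ∈ Sk o, ∀ t ∈ Sk o, ∀ x z, u.b x = t.b z → ∃ c : ℂ, u.a x = c • t.a z

theorem Admissible.signCoherent {o : SuperRootDatum X 𝔥} (ho : Admissible.{w} o) :
    o.SignCoherent := by
  obtain ⟨𝔤⟩ := ho
  exact ⟨fun _ hβ _ ht => 𝔤.pos_or_neg hβ ht, fun _ hu _ ht _ _ h => 𝔤.exists_a_eq_smul hu ht h⟩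

variable {o : SuperRootDatum X 𝔥}

theorem b_mem_realRoots {t : SuperRootDatum X 𝔥} (ht : t ∈ Sk o) (x : X) :
    t.b x ∈ o.realRoots := ⟨t, ht, x, rfl⟩

theorem realRoots_mem_rootLattice {t : SuperRootDatum X 𝔥} (ht : t ∈ Sk o) {β : Module.Dual ℂ 𝔥}
    (hβ : β ∈ o.realRoots) : β ∈ t.rootLattice := by
  obtain ⟨u, hu, x, rfl⟩ := hβ
  exact rootLattice_le (mem_Sk_trans (mem_Sk_symm ht) hu) (u.b_mem_rootLattice x)

theorem realRoots_ne_zero {β : Module.Dual ℂ 𝔥} (hβ : β ∈ o.realRoots) : β ≠ 0 := by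
  obtain ⟨u, hu, x, rfl⟩ := hβ
  exact u.b_indep.ne_zero x

theorem not_pos_neg {β : Module.Dual ℂ 𝔥} (hβ : β ∈ o.realRoots) {t : SuperRootDatum X 𝔥}
    (h1 : t.Pos β) (h2 : t.Pos (-β)) : False :=
  realRoots_ne_zero hβ (h1.eq_zero h2)

/-- Real roots are primitive: a real root that is a natural multiple of a simple root is equal
to it. -/
theorem eq_b_of_coord_eq_zero {t : SuperRootDatum X 𝔥} (ht : t ∈ Sk o) {x : X}
    {β : Module.Dual ℂ 𝔥} (hβ : β ∈ o.realRoots) (hpos : t.Pos β)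
    (h : ∀ y, y ≠ x → t.coord y β = 0) : β = t.b x := by
  cases nonempty_fintype X
  have e : β = t.coord x β • t.b x := by
    conv_lhs => rw [← sum_coord_smul hpos.mem_Vb]
    exact Finset.sum_eq_single x (fun y _ hy => by rw [h y hy, zero_smul]) (by simp)
  obtain ⟨n, hn⟩ := hpos.coord x
  obtain ⟨u, hu, z, rfl⟩ := hβ
  obtain ⟨k, hk⟩ := exists_int_coord (realRoots_mem_rootLattice hu (b_mem_realRoots ht x)) z
  have h1 := congrArg (u.coord z) e
  rw [coord_b_self, map_smul, hn, hk, smul_eq_mul] at h1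
  have h2 : (n : ℤ) * k = 1 := by exact_mod_cast h1.symm
  have h3 : n = 1 := by
    have := Int.isUnit_iff.1 (IsUnit.of_mul_eq_one _ h2)
    omega
  rw [hn, h3, Nat.cast_one, one_smul] at e
  exact e

/-- A reflexion `r_x` changes the sign of no positive real root other than `b x`. -/
theorem SignCoherent.pos_reflexion (H : o.SignCoherent) {t : SuperRootDatum X 𝔥} (ht : t ∈ Sk o)
    {x : X} (hx : t.Reflectable x) {β : Module.Dual ℂ 𝔥} (hβ : β ∈ o.realRoots) (hpos : t.Pos β)
    (hne : β ≠ t.b x) : (t.reflexion x).Pos β := by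
  refine (H.pos_or_neg β hβ _ (mem_Sk_trans ht (reflexion_mem_Sk hx))).resolve_right fun hneg => ?_
  refine hne (eq_b_of_coord_eq_zero ht hβ hpos fun y hy => hpos.coord_eq_zero hneg fun z => ?_)
  by_cases hz : z = x
  · exact ⟨0, by rw [hz, reflexion_b_self, map_neg, coord_b_of_ne _ hy.symm]; simp⟩
  · obtain ⟨c, hc, _⟩ := exists_reflexion_b hx hz
    obtain ⟨n, hn⟩ := (t.pos_b z).coord y
    exact ⟨n, by rw [hc, map_add, map_nsmul, coord_b_of_ne _ hy.symm, hn]; simp⟩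

/-- A real root positive at `t` and negative at `u` is simple and reflectable at some vertex. -/
theorem SignCoherent.exists_reflectable_eq (H : o.SignCoherent) {β : Module.Dual ℂ 𝔥}
    (hβ : β ∈ o.realRoots) {t u : SuperRootDatum X 𝔥} (ht : t ∈ Sk o) (hu : u ∈ Sk o)
    (h1 : t.Pos β) (h2 : u.Pos (-β)) : ∃ w ∈ Sk o, ∃ z, w.Reflectable z ∧ β = w.b z := by
  obtain ⟨l, hl⟩ := mem_Sk_trans (mem_Sk_symm ht) hu
  induction hl with
  | nil t => exact (not_pos_neg hβ h1 h2).elim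
  | @cons t u x l hx h ih =>
    by_cases hne : β = t.b x
    · exact ⟨t, ht, x, hx, hne⟩
    · exact ih (mem_Sk_trans ht (reflexion_mem_Sk hx)) hu (H.pos_reflexion ht hx hβ h1 hne) h2

/-- The set of real roots is stable under the reflection of an anisotropic reflectable root. -/
theorem reflection_mem_realRoots {t : SuperRootDatum X 𝔥} (ht : t ∈ Sk o) {z : X}
    (hz : t.Reflectable z) (h0 : t.cartan z z ≠ 0) {β : Module.Dual ℂ 𝔥} (hβ : β ∈ o.realRoots) :
    β - (2 / t.cartan z z * β (t.a z)) • t.b z ∈ o.realRoots := by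
  obtain ⟨u, hu, x, rfl⟩ := hβ
  let S : 𝔥 →ₗ[ℂ] 𝔥 := LinearMap.id - ((2 / t.cartan z z) • t.b z).smulRight (t.a z)
  let T : Module.Dual ℂ 𝔥 →ₗ[ℂ] Module.Dual ℂ 𝔥 :=
    LinearMap.id - ((2 / t.cartan z z) • Module.Dual.eval ℂ 𝔥 (t.a z)).smulRight (t.b z)
  have hT : Transport S T (fun _ => 1) t (t.reflexion z) := by
    rw [reflexion_aniso h0]
    refine ⟨fun y => ?_, fun y => ?_, rfl, fun y y' => by rw [aniso_cartan, one_mul]⟩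
    · rw [one_smul]
      change t.a y - _ • t.a z = t.a y - (2 / t.cartan z z * t.cartan y z) • t.a z
      congr 2; ring
    · change t.b y - _ • t.b z = t.b y - (2 / t.cartan z z * t.cartan z y) • t.b z
      congr 2; ring
  obtain ⟨l, hl⟩ := mem_Sk_trans (mem_Sk_symm ht) hu
  obtain ⟨u', h1, h2⟩ := hT.path (fun _ => one_ne_zero) (P := Reflectable)
    (fun h _ hx => h.reflectable (fun _ => one_ne_zero) hx) hl
  exact ⟨u', mem_Sk_trans ht (mem_Sk_trans (reflexion_mem_Sk hz) ⟨l, h1⟩), x, (h2.b_eq x).symm⟩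

/-- Reflectability of a simple root does not depend on the vertex. -/
theorem SignCoherent.reflectable_of_eq (H : o.SignCoherent) {u t : SuperRootDatum X 𝔥}
    (hu : u ∈ Sk o) (ht : t ∈ Sk o) {x z : X} (h : u.b x = t.b z) (hz : t.Reflectable z) :
    u.Reflectable x := by
  obtain ⟨c, hc⟩ := H.exists_a_eq_smul u hu t ht x z h
  have hc0 : c ≠ 0 := by
    rintro rfl
    exact u.a_indep.ne_zero x (by rw [hc, zero_smul])
  have hxx : u.cartan x x = c * t.cartan z z := by
    rw [cartan, cartan, h, hc, map_smul, smul_eq_mul]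
  have hp : u.p x = t.p z := by
    rw [← parity_b hu x, ← parity_b ht z]
    congr 2
  by_cases h0 : t.cartan z z = 0
  · refine Or.inl ⟨by rw [hxx, h0, mul_zero], ?_⟩
    rcases hz with hz | hz | hz
    · rw [hp, hz.2]
    · exact absurd h0 hz.1
    · exact absurd h0 hz.1
  · have hxx0 : u.cartan x x ≠ 0 := by rw [hxx]; exact mul_ne_zero hc0 h0
    have hdiv : ∀ y, u.cartan x y / u.cartan x x = (u.b y) (t.a z) / t.cartan z z := fun y => by
      rw [hxx, cartan, hc, map_smul, smul_eq_mul, mul_div_mul_left _ _ hc0]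
    -- integrality on the root lattice passes from `t` to `u`; the sign comes from sign coherence
    have key : ∀ k : ℂ, (k = 1 ∨ k = 2) →
        (∀ y, y ≠ z → ∃ n : ℕ, 2 / t.cartan z z * t.cartan z y = -(n : ℂ) * k) →
        ∀ y, y ≠ x → ∃ n : ℕ, 2 * (u.cartan x y / u.cartan x x) = -(n : ℂ) * k := by
      intro k hk ht' y hy
      obtain ⟨m, hm⟩ := exists_int_of_mem_rootLattice (t := t)
        ((2 / t.cartan z z) • Module.Dual.eval ℂ 𝔥 (t.a z)) (k := k) (fun y => by
          change ∃ n : ℤ, 2 / t.cartan z z * t.cartan z y = n * k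
          by_cases hy : y = z
          · rw [hy, div_mul_cancel₀ _ h0]
            rcases hk with rfl | rfl
            · exact ⟨2, by norm_num⟩
            · exact ⟨1, by norm_num⟩
          · obtain ⟨n, hn⟩ := ht' y hy
            exact ⟨-n, by rw [hn]; push_cast; ring⟩)
        (realRoots_mem_rootLattice ht (b_mem_realRoots hu y))
      replace hm : 2 / t.cartan z z * (u.b y) (t.a z) = m * k := hm
      have hm' : 2 * (u.cartan x y / u.cartan x x) = m * k := by rw [hdiv, ← hm]; ring
      have hroot := reflection_mem_realRoots ht hz h0 (b_mem_realRoots hu y)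
      rw [hm, ← h] at hroot
      have hpos : u.Pos (u.b y - (m * k) • u.b x) := by
        refine (H.pos_or_neg _ hroot u hu).resolve_right fun hneg => ?_
        obtain ⟨n, hn⟩ := hneg.coord y
        rw [map_neg, map_sub, map_smul, coord_b_self, coord_b_of_ne _ hy.symm] at hn
        have : ((n + 1 : ℕ) : ℂ) = 0 := by push_cast; rw [← hn]; simp
        exact absurd this (Nat.cast_ne_zero.2 (by omega))
      obtain ⟨n, hn⟩ := hpos.coord x
      rw [map_sub, map_smul, coord_b_self, coord_b_of_ne _ hy] at hn
      have hmk : m ≤ 0 := by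
        rcases hk with rfl | rfl
        · have : -m = (n : ℤ) := by
            have : ((-m : ℤ) : ℂ) = ((n : ℤ) : ℂ) := by push_cast; rw [← hn]; simp
            exact_mod_cast this
          omega
        · have : -(2 * m) = (n : ℤ) := by
            have : ((-(2 * m) : ℤ) : ℂ) = ((n : ℤ) : ℂ) := by push_cast; rw [← hn]; simp; ring
            exact_mod_cast this
          omega
      refine ⟨(-m).toNat, ?_⟩
      rw [hm']
      have e : (((-m).toNat : ℤ) : ℂ) = ((-m : ℤ) : ℂ) := by rw [Int.toNat_of_nonneg (by omega)]
      rw [Int.cast_natCast] at e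
      rw [e]; push_cast; ring
    rcases hz with hz | hz | hz
    · exact absurd hz.1 h0
    · refine Or.inr (Or.inl ⟨hxx0, by rw [hp, hz.2.1], fun y hy => ?_⟩)
      obtain ⟨n, hn⟩ := key 1 (Or.inl rfl) (fun y hy => by
        obtain ⟨n, hn⟩ := hz.2.2 y hy
        exact ⟨n, by rw [mul_one, ← hn]; ring⟩) y hy
      exact ⟨n, by rw [mul_div_assoc, hn, mul_one]⟩
    · refine Or.inr (Or.inr ⟨hxx0, by rw [hp, hz.2.1], fun y hy => ?_⟩)
      obtain ⟨n, hn⟩ := key 2 (Or.inr rfl) (fun y hy => by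
        obtain ⟨n, hn⟩ := hz.2.2 y hy
        exact ⟨n, by rw [← hn]; ring⟩) y hy
      exact ⟨n, by linear_combination hn / 2⟩

/-- A simple root at `t` that is negative at some vertex is reflectable at `t`. -/
theorem SignCoherent.reflectable_of_neg (H : o.SignCoherent) {t u : SuperRootDatum X 𝔥}
    (ht : t ∈ Sk o) (hu : u ∈ Sk o) {x : X} (h : u.Pos (-t.b x)) : t.Reflectable x := by
  obtain ⟨w, hw, z, hz, e⟩ := H.exists_reflectable_eq (b_mem_realRoots ht x) ht hu (t.pos_b x) h
  exact H.reflectable_of_eq ht hw e hz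

/-! ### Real roots whose sign changes between two vertices -/

/-- The real roots that are positive at `t` and negative at `u`. -/
def flipped (o t u : SuperRootDatum X 𝔥) : Set (Module.Dual ℂ 𝔥) :=
  {β | β ∈ o.realRoots ∧ t.Pos β ∧ u.Pos (-β)}

theorem flipped_self (t : SuperRootDatum X 𝔥) : flipped o t t = ∅ :=
  Set.eq_empty_of_forall_notMem fun _ h => not_pos_neg h.1 h.2.1 h.2.2

theorem SignCoherent.neg_reflexion (H : o.SignCoherent) {t : SuperRootDatum X 𝔥} (ht : t ∈ Sk o)
    {x : X} (hx : t.Reflectable x) {β : Module.Dual ℂ 𝔥} (hβ : β ∈ o.realRoots)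
    (hneg : t.Pos (-β)) (hne : β ≠ -t.b x) : (t.reflexion x).Pos (-β) := by
  have ht' := mem_Sk_trans ht (reflexion_mem_Sk hx)
  refine (H.pos_or_neg β hβ _ ht').resolve_left fun hpos => ?_
  have h := H.pos_reflexion ht' (reflexion_invol hx).1 hβ hpos (by rwa [reflexion_b_self])
  rw [(reflexion_invol hx).2] at h
  exact not_pos_neg hβ h hneg

theorem SignCoherent.flipped_subset_insert (H : o.SignCoherent) {t : SuperRootDatum X 𝔥}
    (ht : t ∈ Sk o) {x : X} (hx : t.Reflectable x) (u : SuperRootDatum X 𝔥) :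
    flipped o t u ⊆ insert (t.b x) (flipped o (t.reflexion x) u) := by
  rintro β ⟨h1, h2, h3⟩
  by_cases hne : β = t.b x
  · exact Or.inl hne
  · exact Or.inr ⟨h1, H.pos_reflexion ht hx h1 h2 hne, h3⟩

/-- The number of roots whose sign changes along a chain is at most its length. -/
theorem SignCoherent.flipped_finite_ncard_le (H : o.SignCoherent) {t u : SuperRootDatum X 𝔥}
    (ht : t ∈ Sk o) {l : List X} (h : Path Reflectable t l u) :
    (flipped o t u).Finite ∧ (flipped o t u).ncard ≤ l.length := by
  induction h with
  | nil t => rw [flipped_self]; simp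
  | @cons t u x l hx h ih =>
    obtain ⟨h1, h2⟩ := ih (mem_Sk_trans ht (reflexion_mem_Sk hx))
    have hs := H.flipped_subset_insert ht hx u
    exact ⟨(h1.insert _).subset hs, (Set.ncard_le_ncard hs (h1.insert _)).trans
      ((Set.ncard_insert_le _ _).trans (Nat.succ_le_succ h2))⟩

theorem SignCoherent.flipped_finite (H : o.SignCoherent) {t u : SuperRootDatum X 𝔥} (ht : t ∈ Sk o)
    (hu : u ∈ Sk o) : (flipped o t u).Finite := by
  obtain ⟨l, hl⟩ := mem_Sk_trans (mem_Sk_symm ht) hu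
  exact (H.flipped_finite_ncard_le ht hl).1

theorem notMem_flipped_reflexion {t u : SuperRootDatum X 𝔥} {x : X} :
    t.b x ∉ flipped o (t.reflexion x) u := fun h =>
  not_pos_neg h.1 h.2.1 (by rw [← reflexion_b_self]; exact pos_b _ _)

theorem SignCoherent.flipped_reflexion_left (H : o.SignCoherent) {t u : SuperRootDatum X 𝔥}
    (ht : t ∈ Sk o) {x : X} (hx : t.Reflectable x) (h : u.Pos (-t.b x)) :
    flipped o t u = insert (t.b x) (flipped o (t.reflexion x) u) := by
  refine (H.flipped_subset_insert ht hx u).antisymm (Set.insert_subset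
    ⟨b_mem_realRoots ht x, t.pos_b x, h⟩ ?_)
  rintro β ⟨h1, h2, h3⟩
  refine ⟨h1, (H.pos_or_neg β h1 t ht).resolve_right fun hneg => ?_, h3⟩
  have hβ : β = -t.b x := by
    by_contra hne
    exact not_pos_neg h1 h2 (H.neg_reflexion ht hx h1 hneg hne)
  rw [hβ, neg_neg] at h3
  exact not_pos_neg (b_mem_realRoots ht x) h3 h

theorem SignCoherent.ncard_flipped_reflexion_left (H : o.SignCoherent) {t u : SuperRootDatum X 𝔥}
    (ht : t ∈ Sk o) (hu : u ∈ Sk o) {x : X} (hx : t.Reflectable x) (h : u.Pos (-t.b x)) :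
    (flipped o t u).ncard = (flipped o (t.reflexion x) u).ncard + 1 := by
  rw [H.flipped_reflexion_left ht hx h, Set.ncard_insert_of_notMem notMem_flipped_reflexion
    (H.flipped_finite (mem_Sk_trans ht (reflexion_mem_Sk hx)) hu)]

theorem SignCoherent.flipped_reflexion_right (H : o.SignCoherent) {t s : SuperRootDatum X 𝔥}
    (hs : s ∈ Sk o) {x : X} (hx : s.Reflectable x) (h : t.Pos (s.b x)) :
    flipped o t (s.reflexion x) = insert (s.b x) (flipped o t s) := by
  have hs' := mem_Sk_trans hs (reflexion_mem_Sk hx)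
  refine Set.Subset.antisymm ?_ (Set.insert_subset ⟨b_mem_realRoots hs x, h, ?_⟩ ?_)
  · rintro β ⟨h1, h2, h3⟩
    by_cases hne : β = s.b x
    · exact Or.inl hne
    · refine Or.inr ⟨h1, h2, (H.pos_or_neg β h1 s hs).resolve_left fun hpos => ?_⟩
      exact not_pos_neg h1 (H.pos_reflexion hs hx h1 hpos hne) h3
  · rw [← reflexion_b_self]; exact pos_b _ _
  · rintro β ⟨h1, h2, h3⟩
    refine ⟨h1, h2, H.neg_reflexion hs hx h1 h3 fun hβ => ?_⟩
    rw [hβ] at h2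
    exact not_pos_neg (b_mem_realRoots hs x) h h2

theorem SignCoherent.ncard_flipped_reflexion_right (H : o.SignCoherent) {t s : SuperRootDatum X 𝔥}
    (ht : t ∈ Sk o) (hs : s ∈ Sk o) {x : X} (hx : s.Reflectable x) (h : t.Pos (s.b x)) :
    (flipped o t (s.reflexion x)).ncard = (flipped o t s).ncard + 1 := by
  rw [H.flipped_reflexion_right hs hx h, Set.ncard_insert_of_notMem
    (fun h' => not_pos_neg h'.1 (s.pos_b x) h'.2.2) (H.flipped_finite ht hs)]

theorem SignCoherent.exists_neg_of_flipped_nonempty {t u : SuperRootDatum X 𝔥} (H : o.SignCoherent)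
    (ht : t ∈ Sk o) (hu : u ∈ Sk o) (h : (flipped o t u).Nonempty) : ∃ x, u.Pos (-t.b x) := by
  by_contra! hcon
  obtain ⟨β, h1, h2, h3⟩ := h
  refine not_pos_neg h1 ((AddSubmonoid.closure_le (S := AddSubmonoid.closure (Set.range u.b))).2 ?_
    h2) h3
  rintro _ ⟨x, rfl⟩
  exact (H.pos_or_neg _ (b_mem_realRoots ht x) u hu).resolve_right (hcon x)

theorem SignCoherent.neg_mem_realRoots (H : o.SignCoherent) {t u : SuperRootDatum X 𝔥}
    (ht : t ∈ Sk o)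
    (hu : u ∈ Sk o) {β : Module.Dual ℂ 𝔥} (h : β ∈ flipped o t u) : -β ∈ o.realRoots := by
  obtain ⟨w, hw, z, hz, rfl⟩ := H.exists_reflectable_eq h.1 ht hu h.2.1 h.2.2
  rw [← reflexion_b_self]
  exact b_mem_realRoots (mem_Sk_trans hw (reflexion_mem_Sk hz)) z

/-- The set `flipped o s u` determines the sets `flipped o t u` for all `t`. -/
theorem SignCoherent.flipped_subset_of_eq (H : o.SignCoherent) {s t u u' : SuperRootDatum X 𝔥}
    (hs : s ∈ Sk o)
    (ht : t ∈ Sk o) (hu : u ∈ Sk o) (hu' : u' ∈ Sk o) (h : flipped o s u = flipped o s u') :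
    flipped o t u ⊆ flipped o t u' := by
  intro β hβ
  have hβ' := H.neg_mem_realRoots ht hu hβ
  obtain ⟨h1, h2, h3⟩ := hβ
  refine ⟨h1, h2, ?_⟩
  rcases H.pos_or_neg β h1 s hs with h4 | h4
  · exact (h ▸ (⟨h1, h4, h3⟩ : β ∈ flipped o s u) : β ∈ flipped o s u').2.2
  · refine (H.pos_or_neg β h1 u' hu').resolve_left fun h5 => ?_
    have h6 : -β ∈ flipped o s u' := ⟨hβ', h4, by rwa [neg_neg]⟩
    rw [← h] at h6
    exact not_pos_neg hβ' h3 h6.2.2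

theorem SignCoherent.flipped_congr (H : o.SignCoherent) {s t u u' : SuperRootDatum X 𝔥}
    (hs : s ∈ Sk o)
    (ht : t ∈ Sk o) (hu : u ∈ Sk o) (hu' : u' ∈ Sk o) (h : flipped o s u = flipped o s u') :
    flipped o t u = flipped o t u' :=
  (H.flipped_subset_of_eq hs ht hu hu' h).antisymm (H.flipped_subset_of_eq hs ht hu' hu h.symm)

theorem SignCoherent.flipped_eq_union (H : o.SignCoherent) {t s u : SuperRootDatum X 𝔥}
    (ht : t ∈ Sk o) (hs : s ∈ Sk o) (hu : u ∈ Sk o) (h : flipped o t s ⊆ flipped o t u) :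
    flipped o t u = flipped o t s ∪ flipped o s u := by
  refine Set.Subset.antisymm ?_ (Set.union_subset h ?_)
  · rintro β ⟨h1, h2, h3⟩
    rcases H.pos_or_neg β h1 s hs with h4 | h4
    · exact Or.inr ⟨h1, h4, h3⟩
    · exact Or.inl ⟨h1, h2, h4⟩
  · intro β hβ
    have hβ' := H.neg_mem_realRoots hs hu hβ
    obtain ⟨h1, h2, h3⟩ := hβ
    refine ⟨h1, (H.pos_or_neg β h1 t ht).resolve_right fun h4 => ?_, h3⟩
    have h5 := h (⟨hβ', h4, by rwa [neg_neg]⟩ : -β ∈ flipped o t s)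
    exact not_pos_neg hβ' h3 h5.2.2

theorem SignCoherent.ncard_flipped_add (H : o.SignCoherent) {t s u : SuperRootDatum X 𝔥}
    (ht : t ∈ Sk o) (hs : s ∈ Sk o) (hu : u ∈ Sk o) (h : flipped o t s ⊆ flipped o t u) :
    (flipped o t u).ncard = (flipped o t s).ncard + (flipped o s u).ncard := by
  rw [H.flipped_eq_union ht hs hu h]
  refine Set.ncard_union_eq ?_ (H.flipped_finite ht hs) (H.flipped_finite hs hu)
  exact Set.disjoint_left.2 fun β h1 h2 => not_pos_neg h1.1 h2.2.1 h1.2.2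

/-! ### Rank two -/

/-- The real roots that are positive at `t` and lie in the plane spanned by `b x` and `b y`. -/
def planeRoots (o t : SuperRootDatum X 𝔥) (x y : X) : Set (Module.Dual ℂ 𝔥) :=
  {β | β ∈ o.realRoots ∧ t.Pos β ∧ ∀ z, z ≠ x → z ≠ y → t.coord z β = 0}

theorem planeRoots_comm (t : SuperRootDatum X 𝔥) (x y : X) :
    planeRoots o t x y = planeRoots o t y x := by
  ext β
  exact and_congr_right fun _ => and_congr_right fun _ =>
    forall_congr' fun z => ⟨fun h h1 h2 => h h2 h1, fun h h1 h2 => h h2 h1⟩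

theorem eq_add_of_coord_eq_zero {t : SuperRootDatum X 𝔥} {β : Module.Dual ℂ 𝔥} (hβ : β ∈ t.Vb)
    {x y : X} (hxy : x ≠ y) (h : ∀ z, z ≠ x → z ≠ y → t.coord z β = 0) :
    β = t.coord x β • t.b x + t.coord y β • t.b y := by
  classical
  cases nonempty_fintype X
  conv_lhs => rw [← sum_coord_smul hβ]
  rw [← Finset.sum_pair (f := fun z => t.coord z β • t.b z) hxy]
  refine (Finset.sum_subset (Finset.subset_univ _) fun z _ hz => ?_).symm
  rw [Finset.mem_insert, Finset.mem_singleton, not_or] at hz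
  rw [h z hz.1 hz.2, zero_smul]

theorem exists_nat_eq_add {t : SuperRootDatum X 𝔥} {β : Module.Dual ℂ 𝔥} (hβ : t.Pos β)
    {x y : X} (hxy : x ≠ y) (h : ∀ z, z ≠ x → z ≠ y → t.coord z β = 0) :
    ∃ m n : ℕ, β = m • t.b x + n • t.b y := by
  obtain ⟨m, hm⟩ := hβ.coord x
  obtain ⟨n, hn⟩ := hβ.coord y
  refine ⟨m, n, ?_⟩
  rw [← Nat.cast_smul_eq_nsmul ℂ, ← Nat.cast_smul_eq_nsmul ℂ, ← hm, ← hn]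
  exact eq_add_of_coord_eq_zero hβ.mem_Vb hxy h

theorem planeRoots_subset_flipped {t u : SuperRootDatum X 𝔥} {x y : X} (hxy : x ≠ y)
    (hx : u.Pos (-t.b x)) (hy : u.Pos (-t.b y)) : planeRoots o t x y ⊆ flipped o t u := by
  rintro β ⟨h1, h2, h3⟩
  refine ⟨h1, h2, ?_⟩
  obtain ⟨m, n, rfl⟩ := exists_nat_eq_add h2 hxy h3
  rw [neg_add, ← smul_neg, ← smul_neg]
  exact add_mem (nsmul_mem hx m) (nsmul_mem hy n)

/-- `φ` and the scalars `ν` symmetrize the rank two Cartan matrix of `x`, `y` at `s`: the vectors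
`a x`, `a y` are `ν`-multiples of the images by `φ` of `b x`, `b y`. -/
structure Symmetrizes (φ : Module.Dual ℂ 𝔥 →ₗ[ℂ] 𝔥) (ν : X → ℂ) (x y : X)
    (s : SuperRootDatum X 𝔥) : Prop where
  ν_left : ν x ≠ 0
  ν_right : ν y ≠ 0
  a_left : s.a x = ν x • φ (s.b x)
  a_right : s.a y = ν y • φ (s.b y)
  cartan_eq : s.cartan x y * ν y = s.cartan y x * ν x

omit [Finite X] in
theorem Symmetrizes.symm {φ : Module.Dual ℂ 𝔥 →ₗ[ℂ] 𝔥} {ν : X → ℂ} {x y : X}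
    {s : SuperRootDatum X 𝔥} (h : Symmetrizes φ ν x y s) : Symmetrizes φ ν y x s :=
  ⟨h.ν_right, h.ν_left, h.a_right, h.a_left, h.cartan_eq.symm⟩

theorem Symmetrizes.reflexion {φ : Module.Dual ℂ 𝔥 →ₗ[ℂ] 𝔥} {ν : X → ℂ} {x y : X} (hyx : y ≠ x)
    {s : SuperRootDatum X 𝔥} (h : Symmetrizes φ ν x y s) :
    Symmetrizes φ ν x y (s.reflexion x) := by
  have hx := h.ν_left
  have hC := h.cartan_eq
  refine ⟨hx, h.ν_right, ?_, ?_, ?_⟩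
  · rw [reflexion_a_self, reflexion_b_self, h.a_left, map_neg, smul_neg]
  · by_cases h0 : s.cartan x x = 0
    · rw [reflexion_iso h0]
      by_cases h1 : s.cartan x y = 0
      · simp [isotropicReflexion, hyx, h1, h.a_right]
      · simp only [isotropicReflexion, hyx, h1, if_false, map_add, smul_add]
        rw [h.a_right, h.a_left, smul_smul]
        congr 2
        field_simp
        linear_combination -hC
    · rw [reflexion_aniso h0]
      simp only [anisotropicReflexion, map_sub, map_smul, smul_sub]
      rw [h.a_right, h.a_left, smul_smul, smul_smul]
      congr 2
      field_simp
      linear_combination -hC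
  · by_cases h0 : s.cartan x x = 0
    · rw [reflexion_iso h0, iso_cartan_left h0, iso_cartan_right h0]
      linear_combination -hC
    · rw [reflexion_aniso h0, aniso_cartan, hC]

/-- What a chain of reflexions `r_x`, `r_y` starting at `t` preserves. -/
structure RankTwo (φ : Module.Dual ℂ 𝔥 →ₗ[ℂ] 𝔥) (ν : X → ℂ) (t : SuperRootDatum X 𝔥) (x y : X)
    (s : SuperRootDatum X 𝔥) : Prop where
  symm : Symmetrizes φ ν x y s
  b_sub_mem : ∀ z, s.b z - t.b z ∈ Submodule.span ℂ {t.b x, t.b y}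
  a_sub_mem : ∀ z, s.a z - t.a z ∈ Submodule.span ℂ {t.a x, t.a y}

omit [Finite X] in
theorem RankTwo.swap {φ : Module.Dual ℂ 𝔥 →ₗ[ℂ] 𝔥} {ν : X → ℂ} {x y : X}
    {t s : SuperRootDatum X 𝔥} (h : RankTwo φ ν t x y s) : RankTwo φ ν t y x s :=
  ⟨h.symm.symm, by rw [Set.pair_comm]; exact h.b_sub_mem, by rw [Set.pair_comm]; exact h.a_sub_mem⟩

theorem RankTwo.reflexion_left {φ : Module.Dual ℂ 𝔥 →ₗ[ℂ] 𝔥} {ν : X → ℂ} {x y : X} (hxy : x ≠ y)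
    {t s : SuperRootDatum X 𝔥} (h : RankTwo φ ν t x y s) (hx : s.Reflectable x) :
    RankTwo φ ν t x y (s.reflexion x) := by
  refine ⟨h.symm.reflexion hxy.symm, fun z => ?_, fun z => ?_⟩
  · have h1 : s.b x ∈ Submodule.span ℂ {t.b x, t.b y} := by
      have := add_mem (h.b_sub_mem x) (Submodule.subset_span (Set.mem_insert (t.b x) {t.b y}))
      rwa [sub_add_cancel] at this
    by_cases hz : z = x
    · rw [hz, reflexion_b_self]
      have := add_mem (h.b_sub_mem x) (Submodule.smul_mem _ (-2 : ℂ) h1)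
      convert this using 1
      module
    · obtain ⟨c, hc, _⟩ := exists_reflexion_b hx hz
      rw [hc, add_sub_right_comm]
      exact add_mem (h.b_sub_mem z) (nsmul_mem h1 c)
  · have h1 : s.a x ∈ Submodule.span ℂ {t.a x, t.a y} := by
      have := add_mem (h.a_sub_mem x) (Submodule.subset_span (Set.mem_insert (t.a x) {t.a y}))
      rwa [sub_add_cancel] at this
    by_cases hz : z = x
    · rw [hz, reflexion_a_self]
      have := add_mem (h.a_sub_mem x) (Submodule.smul_mem _ (-2 : ℂ) h1)
      convert this using 1
      module
    · obtain ⟨c, hc⟩ := exists_reflexion_a (v := s) hz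
      rw [hc, add_sub_right_comm]
      exact add_mem (h.a_sub_mem z) (Submodule.smul_mem _ c h1)

theorem RankTwo.reflexion {φ : Module.Dual ℂ 𝔥 →ₗ[ℂ] 𝔥} {ν : X → ℂ} {x y : X} (hxy : x ≠ y)
    {t s : SuperRootDatum X 𝔥} (h : RankTwo φ ν t x y s) {c : X} (hc : c = x ∨ c = y)
    (hx : s.Reflectable c) : RankTwo φ ν t x y (s.reflexion c) := by
  rcases hc with rfl | rfl
  · exact h.reflexion_left hxy hx
  · exact (h.swap.reflexion_left hxy.symm hx).swap

omit [Finite X] in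
/-- Coordinates outside the plane are constant along a rank two chain. -/
theorem RankTwo.coord_eq {φ : Module.Dual ℂ 𝔥 →ₗ[ℂ] 𝔥} {ν : X → ℂ} {x y : X}
    {t s : SuperRootDatum X 𝔥} (h : RankTwo φ ν t x y s) {z : X} (hzx : z ≠ x) (hzy : z ≠ y)
    {β : Module.Dual ℂ 𝔥} (hβ : β ∈ s.Vb) : s.coord z β = t.coord z β := by
  have hP : ∀ γ ∈ Submodule.span ℂ {t.b x, t.b y}, t.coord z γ = 0 := by
    intro γ hγ
    obtain ⟨p, q, rfl⟩ := Submodule.mem_span_pair.1 hγ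
    rw [map_add, map_smul, map_smul, coord_b_of_ne _ hzx.symm, coord_b_of_ne _ hzy.symm]
    simp
  induction hβ using Submodule.span_induction with
  | mem β hβ =>
    obtain ⟨w, rfl⟩ := hβ
    have h1 := hP _ (h.b_sub_mem w)
    rw [map_sub, sub_eq_zero] at h1
    rw [h1]
    by_cases hw : w = z
    · rw [hw, coord_b_self, coord_b_self]
    · rw [coord_b_of_ne _ hw, coord_b_of_ne _ hw]
  | zero => simp
  | add β γ _ _ h1 h2 => rw [map_add, map_add, h1, h2]
  | smul c β _ h => rw [map_smul, map_smul, h]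

/-- The end of a maximal rank two chain of length `n`: all plane roots have become negative, and
the names of the simple roots in the plane are exchanged according to the parity of `n`. -/
structure IsOpposite (o : SuperRootDatum X 𝔥) (φ : Module.Dual ℂ 𝔥 →ₗ[ℂ] 𝔥) (ν : X → ℂ)
    (t : SuperRootDatum X 𝔥) (x y : X) (n : ℕ) (s : SuperRootDatum X 𝔥) : Prop where
  flipped_eq : flipped o t s = planeRoots o t x y
  ncard_eq : (planeRoots o t x y).ncard = n
  rankTwo : RankTwo φ ν t x y s
  b_odd : Odd n → s.b x = -t.b y ∧ s.b y = -t.b x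
  b_even : Even n → s.b x = -t.b x ∧ s.b y = -t.b y

/-- Let `s` be reached from `t` by an alternating chain beginning with `r_x`, with next letter `c`
and previous letter `c'`. As long as `b_t(y)` is positive at `s`, the root `b_s(c)` is a plane root
positive at `t`, so the chain can be continued; it ends when `b_s(c) = b_t(y)`. -/
theorem SignCoherent.exists_isOpposite_of_chain (H : o.SignCoherent) {t u : SuperRootDatum X 𝔥}
    (ht : t ∈ Sk o)
    (hu : u ∈ Sk o) {x y : X} (hxy : x ≠ y) (hux : u.Pos (-t.b x)) (huy : u.Pos (-t.b y))
    {φ : Module.Dual ℂ 𝔥 →ₗ[ℂ] 𝔥} {ν : X → ℂ} (k : ℕ) :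
    ∀ (s : SuperRootDatum X 𝔥) (l : List X) (c c' : X), Path Reflectable t l s →
      flipped o t s ⊆ planeRoots o t x y → (flipped o t s).ncard = l.length →
      (planeRoots o t x y).ncard < l.length + k → RankTwo φ ν t x y s →
      (c = x ∧ c' = y ∧ Even l.length ∨ c = y ∧ c' = x ∧ Odd l.length) →
      t.Pos (-s.b c') → s.Pos (-t.b x) → s.Pos (t.b y) →
      ∃ l' s', Path Reflectable s l' s' ∧ IsOpposite o φ ν t x y (l.length + l'.length) s' := by
  have hfin : (planeRoots o t x y).Finite :=
    (H.flipped_finite ht hu).subset (planeRoots_subset_flipped hxy hux huy)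
  induction k with
  | zero =>
    intro s l c c' _ h1 h2 h3
    have := Set.ncard_le_ncard h1 hfin
    omega
  | succ k ih =>
    intro s l c c' hl h1 h2 h3 hR hcc hc' hsx hsy
    have hs : s ∈ Sk o := mem_Sk_trans ht ⟨l, hl⟩
    have hne : c ≠ c' := by
      rcases hcc with ⟨rfl, rfl, _⟩ | ⟨rfl, rfl, _⟩
      · exact hxy
      · exact hxy.symm
    have hcmem : c = x ∨ c = y := hcc.imp (fun h => h.1) (fun h => h.1)
    have hout : ∀ z, z ≠ c → z ≠ c' → z ≠ x ∧ z ≠ y := by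
      rintro z hz hz'
      rcases hcc with ⟨rfl, rfl, _⟩ | ⟨rfl, rfl, _⟩
      · exact ⟨hz, hz'⟩
      · exact ⟨hz', hz⟩
    have hpos : t.Pos (s.b c) := by
      refine (H.pos_or_neg _ (b_mem_realRoots hs c) t ht).resolve_right fun hneg => ?_
      obtain ⟨m, n, e⟩ := exists_nat_eq_add hsy hne fun z hz hz' => by
        obtain ⟨hzx, hzy⟩ := hout z hz hz'
        rw [hR.coord_eq hzx hzy hsy.mem_Vb, coord_b_of_ne _ hzy.symm]
      refine not_pos_neg (b_mem_realRoots ht y) (t.pos_b y) ?_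
      rw [e, neg_add, ← smul_neg, ← smul_neg]
      exact add_mem (nsmul_mem hneg m) (nsmul_mem hc' n)
    have hmem : s.b c ∈ planeRoots o t x y := by
      refine ⟨b_mem_realRoots hs c, hpos, fun z hzx hzy => ?_⟩
      rw [← hR.coord_eq hzx hzy (s.b_mem_Vb c), coord_b_of_ne]
      rintro rfl
      rcases hcmem with h | h
      · exact hzx h
      · exact hzy h
    have hc : s.Reflectable c :=
      H.reflectable_of_neg hs hu (planeRoots_subset_flipped hxy hux huy hmem).2.2
    have hpath : Path Reflectable s [c] (s.reflexion c) := .cons hc (.nil _)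
    have hpath' := hl.append hpath
    have hs' : s.reflexion c ∈ Sk o := mem_Sk_trans ht ⟨_, hpath'⟩
    have hR' := hR.reflexion hxy hcmem hc
    have hsub : flipped o t (s.reflexion c) ⊆ planeRoots o t x y := by
      rw [H.flipped_reflexion_right hs hc hpos]
      exact Set.insert_subset hmem h1
    have hcard : (flipped o t (s.reflexion c)).ncard = l.length + 1 := by
      rw [H.ncard_flipped_reflexion_right ht hs hc hpos, h2]
    have hsx' : (s.reflexion c).Pos (-t.b x) :=
      H.neg_reflexion hs hc (b_mem_realRoots ht x) hsx fun e => by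
        rw [← neg_eq_iff_eq_neg] at e
        exact not_pos_neg (b_mem_realRoots ht x) (t.pos_b x) (e ▸ hpos)
    by_cases hlast : s.b c = t.b y
    · have hbc : (s.reflexion c).b c = -t.b y := by rw [reflexion_b_self, hlast]
      have hflip : flipped o t (s.reflexion c) = planeRoots o t x y :=
        hsub.antisymm (planeRoots_subset_flipped hxy hsx' (hbc ▸ pos_b _ _))
      -- `-b c'` and `b_t(x)` are natural combinations of one another and `b_t(y)`
      have hbc' : (s.reflexion c).b c' = -t.b x := by
        have hcoord : ∀ z, z ≠ x → z ≠ y → t.coord z ((s.reflexion c).b c') = 0 := by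
          intro z hzx hzy
          rw [← hR'.coord_eq hzx hzy (b_mem_Vb _ c'), coord_b_of_ne]
          rintro rfl
          rcases hcc with ⟨_, h, _⟩ | ⟨_, h, _⟩
          · exact hzy h
          · exact hzx h
        have hneg : t.Pos (-(s.reflexion c).b c') := by
          refine (H.pos_or_neg _ (b_mem_realRoots hs' c') t ht).resolve_left fun h => ?_
          have h' : (s.reflexion c).b c' ∈ planeRoots o t x y :=
            ⟨b_mem_realRoots hs' c', h, hcoord⟩
          rw [← hflip] at h'
          exact not_pos_neg h'.1 (pos_b _ _) h'.2.2
        obtain ⟨i, j, e1⟩ := exists_nat_eq_add hneg hxy fun z hzx hzy => by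
          rw [map_neg, hcoord z hzx hzy, neg_zero]
        obtain ⟨p, q, e2⟩ := exists_nat_eq_add hsx' hne fun z hz hz' => by
          obtain ⟨hzx, hzy⟩ := hout z hz hz'
          rw [hR'.coord_eq hzx hzy hsx'.mem_Vb, map_neg, coord_b_of_ne _ hzx.symm, neg_zero]
        have e3 : t.b x = (q * i) • t.b x + (q * j + p) • t.b y := by
          have : t.b x = q • (-(s.reflexion c).b c') + p • t.b y := by
            rw [← neg_neg (t.b x), e2, hbc]
            module
          rw [e1] at this
          rw [add_smul, mul_smul, mul_smul]
          conv_lhs => rw [this]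
          rw [smul_add, add_assoc]
        have h4 := congrArg (t.coord x) e3
        have h5 := congrArg (t.coord y) e3
        rw [map_add, map_nsmul, map_nsmul, coord_b_self, coord_b_of_ne _ hxy.symm] at h4
        rw [map_add, map_nsmul, map_nsmul, coord_b_self, coord_b_of_ne _ hxy] at h5
        have h4' : q * i = 1 := by
          simp only [nsmul_eq_mul, mul_one, mul_zero, add_zero] at h4
          exact_mod_cast h4.symm
        have h5' : q * j + p = 0 := by
          simp only [nsmul_eq_mul, mul_one, mul_zero, zero_add] at h5
          exact_mod_cast h5.symm
        have hq : q = 1 := Nat.eq_one_of_mul_eq_one_right h4'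
        subst hq
        have hi : i = 1 := by omega
        have hj : j = 0 := by omega
        rw [hi, hj, one_smul, zero_smul, add_zero] at e1
        rw [← e1, neg_neg]
      refine ⟨[c], _, hpath, hflip, by rw [← hflip, hcard]; rfl, hR', fun hodd => ?_, fun hev => ?_⟩
      · rcases hcc with ⟨rfl, rfl, _⟩ | ⟨_, _, h⟩
        · exact ⟨hbc, hbc'⟩
        · exact absurd (h.add_odd odd_one) (Nat.not_even_iff_odd.2 hodd)
      · rcases hcc with ⟨_, _, h⟩ | ⟨rfl, rfl, _⟩
        · exact absurd (h.add_odd odd_one) (Nat.not_odd_iff_even.2 hev)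
        · exact ⟨hbc', hbc⟩
    · obtain ⟨l', s', h4, h5⟩ := ih (s.reflexion c) (l ++ [c]) c' c hpath' hsub
        (by rw [hcard, List.length_append]; rfl)
        (by rw [List.length_append, List.length_singleton]; omega) hR'
        (by
          rw [List.length_append, List.length_singleton]
          rcases hcc with ⟨h, h', hp⟩ | ⟨h, h', hp⟩
          · exact Or.inr ⟨h', h, hp.add_odd odd_one⟩
          · exact Or.inl ⟨h', h, hp.add_odd odd_one⟩)
        (by rw [reflexion_b_self, neg_neg]; exact hpos) hsx'
        (H.pos_reflexion hs hc (b_mem_realRoots ht y) hsy (Ne.symm hlast))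
      refine ⟨c :: l', s', .cons hc h4, ?_⟩
      rw [List.length_append, List.length_singleton, add_assoc, add_comm 1] at h5
      exact h5

/-- The alternating chain `r_x, r_y, r_x, …` can be continued until all plane roots are negative. -/
theorem SignCoherent.exists_isOpposite (H : o.SignCoherent) {t u : SuperRootDatum X 𝔥}
    (ht : t ∈ Sk o)
    (hu : u ∈ Sk o) {x y : X} (hxy : x ≠ y) (hux : u.Pos (-t.b x)) (huy : u.Pos (-t.b y))
    {φ : Module.Dual ℂ 𝔥 →ₗ[ℂ] 𝔥} {ν : X → ℂ} (hφ : Symmetrizes φ ν x y t) :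
    ∃ l s, Path Reflectable t (x :: l) s ∧ IsOpposite o φ ν t x y (l.length + 1) s := by
  have hx := H.reflectable_of_neg ht hu hux
  have hR : RankTwo φ ν t x y t := ⟨hφ, fun z => by simp, fun z => by simp⟩
  obtain ⟨l, s, h1, h2⟩ := H.exists_isOpposite_of_chain ht hu hxy hux huy (φ := φ) (ν := ν)
    ((planeRoots o t x y).ncard) (t.reflexion x) [x] y x (.cons hx (.nil _))
    (by
      rw [H.flipped_reflexion_right ht hx (t.pos_b x), flipped_self]
      rintro _ (rfl | h)
      · exact ⟨b_mem_realRoots ht x, t.pos_b x, fun z hz _ => coord_b_of_ne _ hz.symm⟩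
      · exact h.elim)
    (by rw [H.ncard_flipped_reflexion_right ht ht hx (t.pos_b x), flipped_self]; simp)
    (by simp) (hR.reflexion_left hxy hx)
    (Or.inr ⟨rfl, rfl, odd_one⟩) (by rw [reflexion_b_self, neg_neg]; exact t.pos_b x)
    (by rw [← reflexion_b_self]; exact pos_b _ _)
    (H.pos_reflexion ht hx (b_mem_realRoots ht y) (t.pos_b y)
      fun e => hxy (t.b_indep.injective e).symm)
  refine ⟨l, s, .cons hx h1, ?_⟩
  rw [add_comm]
  exact h2

/-- The Cartan matrix is symmetric up to non-zero factors at pairs of reflectable elements: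
otherwise a simple root at `r_y t` would have mixed signs at `r_x t`. -/
theorem SignCoherent.cartan_eq_zero_symm (H : o.SignCoherent) {t : SuperRootDatum X 𝔥}
    (ht : t ∈ Sk o) {x y : X}
    (hxy : x ≠ y) (hx : t.Reflectable x) (hy : t.Reflectable y) (h : t.cartan x y = 0) :
    t.cartan y x = 0 := by
  by_contra h0
  obtain ⟨c, hc, hc0, _⟩ := exists_reflexion_b hy hxy
  have hs := mem_Sk_trans ht (reflexion_mem_Sk hx)
  have e : (t.reflexion y).b x = -(t.reflexion x).b x + c • (t.reflexion x).b y := by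
    rw [hc, reflexion_b_self, neg_neg, reflexion_b_of_cartan_eq_zero hxy.symm h]
  rcases H.pos_or_neg _ (b_mem_realRoots (mem_Sk_trans ht (reflexion_mem_Sk hy)) x) _ hs
    with h1 | h1
  · obtain ⟨n, hn⟩ := h1.coord x
    rw [e, map_add, map_neg, map_nsmul, coord_b_self, coord_b_of_ne _ hxy.symm] at hn
    have : ((n + 1 : ℕ) : ℂ) = 0 := by push_cast; rw [← hn]; simp
    exact absurd this (Nat.cast_ne_zero.2 (by omega))
  · obtain ⟨n, hn⟩ := h1.coord y
    rw [e, map_neg, map_add, map_neg, map_nsmul, coord_b_self, coord_b_of_ne _ hxy] at hn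
    have : ((n + c : ℕ) : ℂ) = 0 := by push_cast; rw [← hn]; simp
    rw [Nat.cast_eq_zero] at this
    exact hc0 h0 (by omega)

theorem SignCoherent.exists_symmetrizes (H : o.SignCoherent) {t : SuperRootDatum X 𝔥}
    (ht : t ∈ Sk o) {x y : X} (hxy : x ≠ y) (hx : t.Reflectable x) (hy : t.Reflectable y) :
    ∃ φ ν, Symmetrizes φ ν x y t := by
  classical
  obtain ⟨ν, hν, hC⟩ : ∃ ν : X → ℂ, (∀ z, ν z ≠ 0) ∧
      t.cartan x y * ν y = t.cartan y x * ν x := by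
    by_cases h : t.cartan x y = 0
    · exact ⟨fun _ => 1, fun _ => one_ne_zero, by rw [h, H.cartan_eq_zero_symm ht hxy hx hy h]⟩
    · have h' : t.cartan y x ≠ 0 := fun h' => h (H.cartan_eq_zero_symm ht hxy.symm hy hx h')
      -- in rank two, `ν x = a_{xy}` and `ν y = a_{yx}` always symmetrize
      refine ⟨fun z => if z = x then t.cartan x y else t.cartan y x, fun z => ?_, ?_⟩
      · dsimp only; split_ifs <;> assumption
      · simp only [if_true, if_neg hxy.symm]
        exact mul_comm _ _
  obtain ⟨φ, hφ⟩ := exists_linearMap_apply_eq t.b_indep (fun z => (ν z)⁻¹ • t.a z)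
  exact ⟨φ, ν, hν x, hν y, by rw [hφ, smul_inv_smul₀ (hν x)], by rw [hφ, smul_inv_smul₀ (hν y)], hC⟩

/-- Outside the plane, simple roots of two rank two chains differ by a combination of the simple
roots of the plane, with natural coefficients if one is positive at the end of the other. -/
theorem b_sub_eq {t s s' : SuperRootDatum X 𝔥} {x y : X} (hxy : x ≠ y)
    {φ : Module.Dual ℂ 𝔥 →ₗ[ℂ] 𝔥} {ν : X → ℂ} (h : RankTwo φ ν t x y s)
    (h' : RankTwo φ ν t x y s') {z : X} (hzx : z ≠ x) (hzy : z ≠ y) (hpos : s'.Pos (s.b z)) :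
    ∃ m n : ℕ, s.b z - s'.b z = m • s'.b x + n • s'.b y := by
  obtain ⟨m, hm⟩ := hpos.coord x
  obtain ⟨n, hn⟩ := hpos.coord y
  refine ⟨m, n, ?_⟩
  have hV : s.b z - s'.b z ∈ s'.Vb := sub_mem hpos.mem_Vb (s'.b_mem_Vb z)
  have e := eq_add_of_coord_eq_zero hV hxy fun w hwx hwy => by
    rw [map_sub, h'.coord_eq hwx hwy hpos.mem_Vb, ← h.coord_eq hwx hwy (s.b_mem_Vb z)]
    by_cases hw : z = w
    · rw [hw, coord_b_self, coord_b_self, sub_self]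
    · rw [coord_b_of_ne _ hw, coord_b_of_ne _ hw, sub_self]
  rw [map_sub, map_sub, hm, hn, coord_b_of_ne _ hzx, coord_b_of_ne _ hzy, sub_zero, sub_zero,
    Nat.cast_smul_eq_nsmul, Nat.cast_smul_eq_nsmul] at e
  exact e

theorem IsOpposite.pos_b_of_ne (H : o.SignCoherent) {t s s' : SuperRootDatum X 𝔥}
    (ht : t ∈ Sk o) (hs : s ∈ Sk o) (hs' : s' ∈ Sk o) {x y : X} {φ : Module.Dual ℂ 𝔥 →ₗ[ℂ] 𝔥}
    {ν : X → ℂ} {n : ℕ} (h : IsOpposite o φ ν t x y n s) (h' : IsOpposite o φ ν t x y n s')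
    {z : X} (hzx : z ≠ x) (hzy : z ≠ y) : s'.Pos (s.b z) := by
  have hr := b_mem_realRoots hs z
  refine (H.pos_or_neg _ hr s' hs').resolve_right fun hneg => ?_
  rcases H.pos_or_neg _ hr t ht with h1 | h1
  · have h2 : s.b z ∈ flipped o t s' := ⟨hr, h1, hneg⟩
    rw [h'.flipped_eq, ← h.flipped_eq] at h2
    exact not_pos_neg hr (s.pos_b z) h2.2.2
  · obtain ⟨m, hm⟩ := h1.coord z
    rw [map_neg, ← h.rankTwo.coord_eq hzx hzy (s.b_mem_Vb z), coord_b_self] at hm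
    have : ((m + 1 : ℕ) : ℂ) = 0 := by push_cast; rw [← hm]; simp
    exact absurd this (Nat.cast_ne_zero.2 (by omega))

theorem eq_of_a_b {u t : SuperRootDatum X 𝔥} (hu : u ∈ Sk o) (ht : t ∈ Sk o)
    (ha : ∀ z, u.a z = t.a z) (hb : ∀ z, u.b z = t.b z) : u = t := by
  ext z : 2
  · exact ha z
  · exact hb z
  · rw [← parity_b hu z, ← parity_b ht z]
    congr 2
    exact hb z

/-- The two maximal rank two chains starting at `t` have the same end point. On the plane, `a` is
determined by `b` through the symmetrization; elsewhere `a` is determined by `b` up to a factor,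
and the factor is `1` because `a z` is unchanged modulo the plane. -/
theorem IsOpposite.eq (H : o.SignCoherent) {t s s' : SuperRootDatum X 𝔥}
    (ht : t ∈ Sk o) (hs : s ∈ Sk o) (hs' : s' ∈ Sk o) {x y : X} (hxy : x ≠ y)
    {φ : Module.Dual ℂ 𝔥 →ₗ[ℂ] 𝔥} {ν : X → ℂ} {n : ℕ} (h : IsOpposite o φ ν t x y n s)
    (h' : IsOpposite o φ ν t x y n s') : s = s' := by
  have hb : s.b x = s'.b x ∧ s.b y = s'.b y := by
    rcases Nat.even_or_odd n with hn | hn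
    · rw [(h.b_even hn).1, (h.b_even hn).2, (h'.b_even hn).1, (h'.b_even hn).2]
      exact ⟨rfl, rfl⟩
    · rw [(h.b_odd hn).1, (h.b_odd hn).2, (h'.b_odd hn).1, (h'.b_odd hn).2]
      exact ⟨rfl, rfl⟩
  have hball : ∀ z, s.b z = s'.b z := by
    intro z
    by_cases hzx : z = x
    · rw [hzx, hb.1]
    by_cases hzy : z = y
    · rw [hzy, hb.2]
    obtain ⟨m, n, e⟩ := b_sub_eq hxy h.rankTwo h'.rankTwo hzx hzy
      (h.pos_b_of_ne H ht hs hs' h' hzx hzy)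
    obtain ⟨m', n', e'⟩ := b_sub_eq hxy h'.rankTwo h.rankTwo hzx hzy
      (h'.pos_b_of_ne H ht hs' hs h hzx hzy)
    rw [hb.1, hb.2] at e'
    have e0 : (m + m') • s'.b x + (n + n') • s'.b y = 0 := by
      rw [add_smul, add_smul, add_add_add_comm, ← e, ← e']
      abel
    have h1 := congrArg (s'.coord x) e0
    have h2 := congrArg (s'.coord y) e0
    rw [map_add, map_nsmul, map_nsmul, coord_b_self, coord_b_of_ne _ hxy.symm] at h1
    rw [map_add, map_nsmul, map_nsmul, coord_b_self, coord_b_of_ne _ hxy] at h2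
    simp only [nsmul_eq_mul, mul_one, mul_zero, add_zero, zero_add, map_zero,
      Nat.cast_eq_zero] at h1 h2
    rw [show m = 0 by omega, show n = 0 by omega, zero_smul, zero_smul, add_zero, sub_eq_zero] at e
    exact e
  refine eq_of_a_b hs hs' (fun z => ?_) hball
  by_cases hzx : z = x
  · rw [hzx, h.rankTwo.symm.a_left, h'.rankTwo.symm.a_left, hball]
  by_cases hzy : z = y
  · rw [hzy, h.rankTwo.symm.a_right, h'.rankTwo.symm.a_right, hball]
  obtain ⟨c, hc⟩ := H.exists_a_eq_smul s hs s' hs' z z (hball z)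
  obtain ⟨g, hg⟩ := exists_linearMap_apply_eq t.a_indep
    (fun w => open Classical in if w = z then (1 : ℂ) else 0)
  have hP : ∀ γ ∈ Submodule.span ℂ {t.a x, t.a y}, g γ = 0 := by
    intro γ hγ
    obtain ⟨p, q, rfl⟩ := Submodule.mem_span_pair.1 hγ
    rw [map_add, map_smul, map_smul, hg, hg, if_neg (Ne.symm hzx), if_neg (Ne.symm hzy)]
    simp
  have h1 := hP _ (h.rankTwo.a_sub_mem z)
  have h2 := hP _ (h'.rankTwo.a_sub_mem z)
  rw [map_sub, sub_eq_zero, hg, if_pos rfl] at h1 h2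
  rw [hc, map_smul, h2, smul_eq_mul, mul_one] at h1
  rw [hc, h1, one_smul]

/-- The rank two relation: if `b x` and `b y` are both negative at `u`, there are shortest chains
from `t` beginning with `r_x` and with `r_y`, with a common end point lying between `t` and `u`. -/
theorem SignCoherent.exists_common_end (H : o.SignCoherent) {t u : SuperRootDatum X 𝔥}
    (ht : t ∈ Sk o)
    (hu : u ∈ Sk o) {x y : X} (hxy : x ≠ y) (hux : u.Pos (-t.b x)) (huy : u.Pos (-t.b y)) :
    ∃ s l l', Path Reflectable t (x :: l) s ∧ Path Reflectable t (y :: l') s ∧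
      flipped o t s ⊆ flipped o t u ∧ (flipped o t s).ncard = l.length + 1 ∧
      (flipped o t s).ncard = l'.length + 1 := by
  obtain ⟨φ, ν, hφ⟩ := H.exists_symmetrizes ht hxy (H.reflectable_of_neg ht hu hux)
    (H.reflectable_of_neg ht hu huy)
  obtain ⟨l, s, h1, h2⟩ := H.exists_isOpposite ht hu hxy hux huy hφ
  obtain ⟨l', s', h1', h2'⟩ := H.exists_isOpposite ht hu hxy.symm huy hux hφ.symm
  have hlen : l'.length + 1 = l.length + 1 := by
    rw [← h2.ncard_eq, ← h2'.ncard_eq, planeRoots_comm]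
  have h3 : IsOpposite o φ ν t x y (l.length + 1) s' :=
    ⟨by rw [h2'.flipped_eq, planeRoots_comm], h2.ncard_eq, h2'.rankTwo.swap,
      fun h => (h2'.b_odd (hlen ▸ h)).symm, fun h => (h2'.b_even (hlen ▸ h)).symm⟩
  have e := h2.eq H ht (mem_Sk_trans ht ⟨_, h1⟩) (mem_Sk_trans ht ⟨_, h1'⟩) hxy h3
  subst e
  refine ⟨s, l, l', h1, h1', ?_, ?_, ?_⟩
  · rw [h2.flipped_eq]
    exact planeRoots_subset_flipped hxy hux huy
  · rw [h2.flipped_eq, h2.ncard_eq]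
  · rw [h2.flipped_eq, h2.ncard_eq, hlen]

/-! ### Geodesics in the skeleton -/

/-- From `t` there is a shortest chain to a vertex with the same positive system as `u`. That this
vertex is `u` itself is `SignCoherent.eq_of_b_eq`. -/
theorem SignCoherent.exists_path_flipped_eq (H : o.SignCoherent) {u : SuperRootDatum X 𝔥}
    (hu : u ∈ Sk o)
    (n : ℕ) : ∀ t ∈ Sk o, (flipped o t u).ncard = n → ∃ l u', Path Reflectable t l u' ∧
      l.length = n ∧ flipped o t u' = flipped o t u := by
  induction n with
  | zero =>
    intro t ht hn
    refine ⟨[], t, .nil t, rfl, ?_⟩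
    rw [flipped_self, (Set.ncard_eq_zero (H.flipped_finite ht hu)).1 hn]
  | succ n ih =>
    intro t ht hn
    obtain ⟨x, hx⟩ := H.exists_neg_of_flipped_nonempty ht hu
      (Set.nonempty_of_ncard_ne_zero (by omega))
    have hr := H.reflectable_of_neg ht hu hx
    have ht' := mem_Sk_trans ht (reflexion_mem_Sk hr)
    obtain ⟨l, u', h1, h2, h3⟩ := ih _ ht'
      (by have := H.ncard_flipped_reflexion_left ht hu hr hx; omega)
    exact ⟨x :: l, u', .cons hr h1, by rw [List.length_cons, h2],
      H.flipped_congr ht' ht (mem_Sk_trans ht' ⟨_, h1⟩) hu h3⟩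

/-- The first reflexion of a chain of minimal length changes the sign of a root that is negative
at the end point. -/
theorem SignCoherent.neg_of_geodesic (H : o.SignCoherent) {t u : SuperRootDatum X 𝔥}
    (ht : t ∈ Sk o) {x : X}
    {l : List X} (hx : t.Reflectable x) (h : Path Reflectable (t.reflexion x) l u)
    (hn : (flipped o t u).ncard = l.length + 1) :
    u.Pos (-t.b x) ∧ (flipped o (t.reflexion x) u).ncard = l.length := by
  have ht' := mem_Sk_trans ht (reflexion_mem_Sk hx)
  have hu : u ∈ Sk o := mem_Sk_trans ht' ⟨l, h⟩
  obtain ⟨h1, h2⟩ := H.flipped_finite_ncard_le ht' h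
  have hneg : u.Pos (-t.b x) := by
    by_contra hcon
    have hs : flipped o t u ⊆ flipped o (t.reflexion x) u := fun β hβ => by
      rcases H.flipped_subset_insert ht hx u hβ with rfl | h3
      · exact absurd hβ.2.2 hcon
      · exact h3
    have := Set.ncard_le_ncard hs h1
    omega
  refine ⟨hneg, ?_⟩
  have := H.ncard_flipped_reflexion_left ht hu hx hneg
  omega

/-- Two chains of minimal length starting at `t` and leading to the same system of positive real
roots have the same end point. -/
theorem SignCoherent.eq_of_geodesic (H : o.SignCoherent) (n : ℕ) : ∀ (t u u' : SuperRootDatum X 𝔥)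
    (l l' : List X), t ∈ Sk o → Path Reflectable t l u → Path Reflectable t l' u' →
    l.length = n → l'.length = n → (flipped o t u).ncard = n →
    flipped o t u = flipped o t u' → u = u' := by
  induction n with
  | zero =>
    intro t u u' l l' ht h h' hl hl' hn e
    rw [List.length_eq_zero_iff] at hl hl'
    subst hl hl'
    cases h
    cases h'
    rfl
  | succ n ih =>
    intro t u u' l l' ht h h' hl hl' hn e
    cases h with
    | nil => simp at hl
    | @cons _ _ x l hx h =>
    cases h' with
    | nil => simp at hl'
    | @cons _ _ y l' hy h' =>
    rw [List.length_cons, Nat.add_right_cancel_iff] at hl hl'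
    have htx := mem_Sk_trans ht (reflexion_mem_Sk hx)
    have hty := mem_Sk_trans ht (reflexion_mem_Sk hy)
    have hu := mem_Sk_trans htx ⟨l, h⟩
    have hu' := mem_Sk_trans hty ⟨l', h'⟩
    obtain ⟨hux, hnx⟩ := H.neg_of_geodesic ht hx h (by rw [hn, hl])
    obtain ⟨huy', hny⟩ := H.neg_of_geodesic ht hy h' (by rw [← e, hn, hl'])
    by_cases hxy : x = y
    · subst hxy
      exact ih _ _ _ l l' htx h h' hl hl' (by rw [hnx, hl]) (H.flipped_congr ht htx hu hu' e)
    have huy : u.Pos (-t.b y) := by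
      have h1 : t.b y ∈ flipped o t u' := ⟨b_mem_realRoots ht y, t.pos_b y, huy'⟩
      rw [← e] at h1
      exact h1.2.2
    -- both chains are compared with a chain through the opposite vertex of the rank two component
    obtain ⟨s, m, m', h1, h1', h2, h3, h3'⟩ := H.exists_common_end ht hu hxy hux huy
    have hs : s ∈ Sk o := mem_Sk_trans ht ⟨_, h1⟩
    obtain ⟨q, w, h4, h5, h6⟩ := H.exists_path_flipped_eq hu _ s hs rfl
    have hw : w ∈ Sk o := mem_Sk_trans hs ⟨_, h4⟩
    have hadd := H.ncard_flipped_add ht hs hu h2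
    cases h1 with | cons _ h1 =>
    cases h1' with | cons _ h1' =>
    have hew : flipped o t u = flipped o t w := (H.flipped_congr hs ht hw hu h6).symm
    have e1 : u = w := ih _ _ _ l (m ++ q) htx h (h1.append h4) hl
      (by rw [List.length_append]; omega) (by rw [hnx, hl]) (H.flipped_congr ht htx hu hw hew)
    have e2 : u' = w := ih _ _ _ l' (m' ++ q) hty h' (h1'.append h4) hl'
      (by rw [List.length_append]; omega) (by rw [hny, hl'])
      (H.flipped_congr ht hty hu' hw (e.symm.trans hew))
    rw [e1, e2]

/-- Every chain can be replaced by one of minimal length with the same end point. -/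
theorem SignCoherent.exists_geodesic (H : o.SignCoherent) {t u : SuperRootDatum X 𝔥} (ht : t ∈ Sk o)
    {l : List X} (h : Path Reflectable t l u) :
    ∃ l', Path Reflectable t l' u ∧ l'.length = (flipped o t u).ncard := by
  induction h with
  | nil t => exact ⟨[], .nil t, by rw [flipped_self]; simp⟩
  | @cons t u x l hx h ih =>
    have ht' := mem_Sk_trans ht (reflexion_mem_Sk hx)
    have hu := mem_Sk_trans ht' ⟨l, h⟩
    obtain ⟨l', h1, h2⟩ := ih ht'
    rcases H.pos_or_neg _ (b_mem_realRoots ht x) u hu with hpos | hneg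
    -- `r_x` leads away from `u`: a shortest chain from `r_x t` to `u` may be taken through `t`
    · obtain ⟨hx', hinv⟩ := reflexion_invol hx
      have hcard := H.ncard_flipped_reflexion_left ht' hu hx'
        (by rw [reflexion_b_self, neg_neg]; exact hpos)
      rw [hinv] at hcard
      obtain ⟨q, w, h4, h5, h6⟩ := H.exists_path_flipped_eq hu _ t ht rfl
      have hw : w ∈ Sk o := mem_Sk_trans ht ⟨_, h4⟩
      have e : u = w := H.eq_of_geodesic _ _ u w l' (x :: q) ht' h1 (.cons hx' (by rwa [hinv])) h2
        (by rw [List.length_cons, h5, hcard]) rfl (H.flipped_congr ht ht' hu hw h6.symm)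
      exact ⟨q, e ▸ h4, h5⟩
    · exact ⟨x :: l', .cons hx h1, by
        rw [List.length_cons, h2, H.ncard_flipped_reflexion_left ht hu hx hneg]⟩

/-- A vertex of the skeleton is determined by its simple roots. -/
theorem SignCoherent.eq_of_b_eq (H : o.SignCoherent) {t u : SuperRootDatum X 𝔥} (ht : t ∈ Sk o)
    (hu : u ∈ Sk o) (h : t.b = u.b) : t = u := by
  have hP : t.Pos = u.Pos := by
    funext β
    rw [Pos, Pos, h]
  have hempty : flipped o t u = ∅ :=
    Set.eq_empty_of_forall_notMem fun β hβ => not_pos_neg hβ.1 hβ.2.1 (hP ▸ hβ.2.2)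
  obtain ⟨l, hl⟩ := mem_Sk_trans (mem_Sk_symm ht) hu
  obtain ⟨l', h1, h2⟩ := H.exists_geodesic ht hl
  rw [hempty, Set.ncard_empty, List.length_eq_zero_iff] at h2
  subst h2
  cases h1
  rfl

/-! ### The action of `Sk^D(v)` on `V_b` -/

omit [Finite X] in
theorem Transport.apply_a {S : 𝔥 →ₗ[ℂ] 𝔥} {T : Module.Dual ℂ 𝔥 →ₗ[ℂ] Module.Dual ℂ 𝔥} {d : X → ℂ}
    {w w' : SuperRootDatum X 𝔥} (h : Transport S T d w w') (x : X) {β : Module.Dual ℂ 𝔥}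
    (hβ : β ∈ w.Vb) : T β (w'.a x) = d x * β (w.a x) := by
  induction hβ using Submodule.span_induction with
  | mem β hβ =>
    obtain ⟨y, rfl⟩ := hβ
    rw [← h.b_eq]
    exact h.cartan_eq x y
  | zero => simp
  | add β γ _ _ h1 h2 => rw [map_add, LinearMap.add_apply, h1, h2, LinearMap.add_apply, mul_add]
  | smul c β _ h =>
    rw [map_smul, LinearMap.smul_apply, h, LinearMap.smul_apply, smul_eq_mul, smul_eq_mul]
    ring

variable {v : SuperRootDatum X 𝔥}

/-- The linear maps that carry `v` to `u` carry every vertex `w` to its namesake, and `σ_b^u` is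
the restriction of one of them. -/
theorem SkD.exists_transport (u : SkD v) : ∃ S T d, (∀ x, d x ≠ 0) ∧
    (∀ β : v.Vb, ((sigmaB v u.1 u.2.1 : v.Vb →ₗ[ℂ] v.Vb) β : Module.Dual ℂ 𝔥) = T β) ∧
    ∀ w (hw : w ∈ Sk v), Transport S T d w (namesake u w hw) := by
  obtain ⟨S, T, d, hd, ht⟩ := u.2.2.transport
  refine ⟨S, T, d, hd, fun β => ?_, fun w hw => ?_⟩
  · have e : v.Vb.subtype ∘ₗ (sigmaB v u.1 u.2.1 : v.Vb →ₗ[ℂ] v.Vb) = T ∘ₗ v.Vb.subtype := by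
      refine v.simpleBasis.ext fun x => ?_
      change ((sigmaB v u.1 u.2.1 : v.Vb →ₗ[ℂ] v.Vb) (v.simpleBasis x) : Module.Dual ℂ 𝔥) =
        T (v.simpleBasis x : Module.Dual ℂ 𝔥)
      rw [sigmaB_apply, coe_simpleBasis, ht.b_eq]
    exact LinearMap.congr_fun e β
  · obtain ⟨l, hl⟩ := hw
    obtain ⟨w', h1, h2⟩ := ht.path hd (P := Reflectable) (fun h _ hx => h.reflectable hd hx) hl
    rwa [h1.det (namesake_path u w ⟨l, hl⟩ hl)] at h2

theorem sigmaB_one : sigmaB v (1 : SkD v).1 (1 : SkD v).2.1 = 1 := by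
  refine Units.ext (v.simpleBasis.ext fun x => Subtype.ext ?_)
  rw [sigmaB_apply, Units.val_one, Module.End.one_apply, coe_simpleBasis]
  rfl

theorem sigmaB_mul (u₁ u₂ : SkD v) : sigmaB v (u₁ * u₂).1 (u₁ * u₂).2.1 =
    sigmaB v u₁.1 u₁.2.1 * sigmaB v u₂.1 u₂.2.1 := by
  refine Units.ext (v.simpleBasis.ext fun x => Subtype.ext ?_)
  obtain ⟨S, T, d, _, h1, h2⟩ := u₁.exists_transport
  rw [sigmaB_apply, Units.val_mul, Module.End.mul_apply, h1, sigmaB_apply, ← (h2 _ u₂.2.1).b_eq]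
  rfl

/-- The homomorphism `u ↦ σ_b^u`. -/
def sigmaHom (v : SuperRootDatum X 𝔥) : SkD v →* LinearMap.GeneralLinearGroup ℂ v.Vb where
  toFun u := sigmaB v u.1 u.2.1
  map_one' := sigmaB_one
  map_mul' := sigmaB_mul

theorem sigmaHom_injective (H : v.SignCoherent) : Function.Injective (sigmaHom v) := by
  intro u u' h
  refine Subtype.ext (H.eq_of_b_eq u.2.1 u'.2.1 (funext fun x => ?_))
  rw [← sigmaB_apply v u.1 u.2.1, ← sigmaB_apply v u'.1 u'.2.1]
  exact congrArg (fun g : LinearMap.GeneralLinearGroup ℂ v.Vb =>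
    (((g : v.Vb →ₗ[ℂ] v.Vb) (v.simpleBasis x) : v.Vb) : Module.Dual ℂ 𝔥)) h

/-! ### The action of `Sp^D(v)` on the principal roots -/

theorem namesake_mem_Sk (u : SkD v) {w : SuperRootDatum X 𝔥} (hw : w ∈ Sk v) :
    namesake u w hw ∈ Sk v := by
  obtain ⟨l, hl⟩ := hw
  exact mem_Sk_trans u.2.1 ⟨l, namesake_path u w _ hl⟩

theorem namesake_mem_Sp {u : SkD v} (hu : u ∈ SpD v) {w : SuperRootDatum X 𝔥} (hw : w ∈ Sp v) :
    ∃ hw' : w ∈ Sk v, namesake u w hw' ∈ Sp v := by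
  obtain ⟨l, hl⟩ := hw
  obtain ⟨m, hm⟩ : u.1 ∈ Sp v := hu
  exact ⟨⟨l, hl.toSk⟩, _, hm.append (namesake_isoPath u w _ hl)⟩

theorem sigmaB_mem_principalRoots (u : SpD v) (α : v.principalRoots) :
    ((sigmaB v u.1.1 u.1.2.1 : v.Vb →ₗ[ℂ] v.Vb) ⟨α, principalRoots_mem_Vb α.2⟩ :
      Module.Dual ℂ 𝔥) ∈ v.principalRoots := by
  obtain ⟨S, T, d, hd, h1, h2⟩ := u.1.exists_transport
  rw [h1]
  obtain ⟨⟨w, hw, x, hx, e⟩, ⟨w', hw', x', e'⟩⟩ := α.2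
  refine ⟨⟨_, namesake_mem_Sk u.1 hw, x, ⟨(h2 w hw).reflectable hd hx.1, ?_⟩, ?_⟩, ?_⟩
  · rw [(h2 w hw).cartan_eq]
    exact mul_ne_zero (hd x) hx.2
  · rw [(h2 w hw).b_eq]
    exact congrArg T e
  · obtain ⟨hk, hp⟩ := namesake_mem_Sp u.2 hw'
    exact ⟨_, hp, x', (congrArg T e').trans ((h2 w' hk).b_eq x').symm⟩

/-- The action of `Sp^D(v)` on the principal roots by the maps `σ_b^u`. -/
def principalAction (v : SuperRootDatum X 𝔥) : SpD v →* Function.End v.principalRoots where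
  toFun u α := ⟨_, sigmaB_mem_principalRoots u α⟩
  map_one' := by
    funext α
    refine Subtype.ext ?_
    change ((sigmaB v (1 : SkD v).1 (1 : SkD v).2.1 : v.Vb →ₗ[ℂ] v.Vb) _ : Module.Dual ℂ 𝔥) = α
    rw [sigmaB_one]
    rfl
  map_mul' u₁ u₂ := by
    funext α
    refine Subtype.ext ?_
    change ((sigmaB v (u₁.1 * u₂.1).1 (u₁.1 * u₂.1).2.1 : v.Vb →ₗ[ℂ] v.Vb) _ :
      Module.Dual ℂ 𝔥) = _
    rw [sigmaB_mul]
    rfl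

theorem RootAlgebra.existsUnique_isCoroot (𝔤 : RootAlgebra.{w} v) {α : Module.Dual ℂ 𝔥}
    (hα : α ∈ v.principalRoots) : ∃! c, 𝔤.IsCoroot α c := by
  obtain ⟨⟨u, hu, x, hx, rfl⟩, _⟩ := hα
  exact ⟨_, (𝔤.isCoroot_iff hu hx.2 _).2 rfl, fun c hc => (𝔤.isCoroot_iff hu hx.2 c).1 hc⟩

theorem RootAlgebra.coroot_b (𝔤 : RootAlgebra.{w} v) {u : SuperRootDatum X 𝔥} (hu : u ∈ Sk v)
    {x : X} (hx : u.cartan x x ≠ 0) : 𝔤.coroot (u.b x) = (2 / u.cartan x x) • u.a x :=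
  (𝔤.isCoroot_iff hu hx _).1 (Classical.epsilon_spec ⟨_, (𝔤.isCoroot_iff hu hx _).2 rfl⟩)

theorem principalParity_eq {α : v.principalRoots} {w : SuperRootDatum X 𝔥} (hw : w ∈ Sk v) {x : X}
    (h : (α : Module.Dual ℂ 𝔥) = w.b x) : v.principalParity α = w.p x := by
  rw [← parity_b hw x, principalParity]
  congr 2

theorem toHomPerm_mem_dynkinAut (𝔤 : RootAlgebra.{w} v) (u : SpD v) :
    (principalAction v).toHomPerm u ∈ 𝔤.dynkinAut := by
  obtain ⟨S, T, d, hd, h1, h2⟩ := u.1.exists_transport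
  have hT : ∀ α, ((principalAction v).toHomPerm u α : Module.Dual ℂ 𝔥) = T α := fun α => h1 _
  refine ⟨fun α => ?_, fun α β => ?_⟩
  · obtain ⟨⟨w, hw, x, _, e⟩, _⟩ := α.2
    have e' : ((principalAction v).toHomPerm u α : Module.Dual ℂ 𝔥) =
        (namesake u.1 w hw).b x := by rw [hT, e, (h2 w hw).b_eq]
    rw [principalParity_eq hw e, principalParity_eq (namesake_mem_Sk u.1 hw) e', (h2 w hw).p_eq]
  · obtain ⟨⟨w, hw, x, hx, e⟩, _⟩ := α.2
    have hx' : (namesake u.1 w hw).cartan x x ≠ 0 := by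
      rw [(h2 w hw).cartan_eq]
      exact mul_ne_zero (hd x) hx.2
    have hβ : (β : Module.Dual ℂ 𝔥) ∈ w.Vb := by
      rw [Vb_eq hw]
      exact principalRoots_mem_Vb β.2
    rw [hT, hT, e, ← (h2 w hw).b_eq, 𝔤.coroot_b hw hx.2, 𝔤.coroot_b (namesake_mem_Sk u.1 hw) hx',
      map_smul, map_smul, (h2 w hw).apply_a x hβ, (h2 w hw).cartan_eq, smul_eq_mul, smul_eq_mul,
      ← mul_assoc, div_mul_eq_mul_div, mul_comm 2 (d x), mul_div_mul_left _ _ (hd x)]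

end SuperRootDatum

theorem mainTheorem5 {X : Type*} [Finite X] {𝔥 : Type*} [AddCommGroup 𝔥] [Module ℂ 𝔥]
    [FiniteDimensional ℂ 𝔥] (v : SuperRootDatum X 𝔥) (hv : v.Admissible) :
    (∃ Φ : v.SkD →* LinearMap.GeneralLinearGroup ℂ v.Vb,
      (∀ u, Φ u = SuperRootDatum.sigmaB v u.1 u.2.1) ∧ Function.Injective Φ) ∧
    ∀ 𝔤 : v.RootAlgebra,
      (∀ α ∈ v.principalRoots, ∃! c, 𝔤.IsCoroot α c) ∧
      ∃ Ψ : SuperRootDatum.SpD v →* 𝔤.dynkinAut, ∀ u (α : v.principalRoots),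
        (((Ψ u : Equiv.Perm v.principalRoots) α : Module.Dual ℂ 𝔥)) =
          ((SuperRootDatum.sigmaB v u.1.1 u.1.2.1 : v.Vb →ₗ[ℂ] v.Vb)
            ⟨α, SuperRootDatum.principalRoots_mem_Vb α.2⟩ : Module.Dual ℂ 𝔥) :=
  ⟨⟨v.sigmaHom, fun _ => rfl, SuperRootDatum.sigmaHom_injective hv.signCoherent⟩, fun 𝔤 =>
    ⟨fun _ hα => 𝔤.existsUnique_isCoroot hα,
      (v.principalAction.toHomPerm).codRestrict 𝔤.dynkinAut
        (SuperRootDatum.toHomPerm_mem_dynkinAut 𝔤), fun _ _ => rfl⟩⟩
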